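/- Let $n$ be a natural number, let $\beta$ be the standard inner product on $\mathbb R^n$, and let $\mathfrak h$ be the $(2n+1)$-dimensional Heisenberg Lie algebra with basis $\mathbf x_i,\mathbf y_i$ $(1\le i\le n)$, $\mathbf z$, where $[\mathbf x_i,\mathbf y_j]=\delta_{ij}\mathbf z$ and all other brackets of basis vectors vanish. Write $u\wedge v=u\otimes v-v\otimes u$, and consider the following cobrackets $\delta:\mathfrak h\to\mathfrak h\wedge\mathfrak h$, where $\lambda\in\mathbb R$, $\lambda\neq0$, and $J=(J_{ij})$ is a skew-symmetric real $n\times n$ matrix: 1. $\delta_1(\mathbf x_j)=\lambda\,\mathbf x_j\wedge\mathbf z$, $\delta_1(\mathbf y_j)=-\lambda\,\mathbf y_j\wedge\mathbf z$, $\delta_1(\mathbf z)=0$; 2. $\delta_2(\mathbf x_j)=\lambda\,\mathbf x_j\wedge\mathbf z$, $\delta_2(\mathbf y_j)=\lambda\,\mathbf y_j\wedge\mathbf z$, $\delta_2(\mathbf z)=0$; 3. $\delta_3(\mathbf x_j)=0$, $\delta_3(\mathbf y_j)=\sum_i J_{ij}\,\mathbf x_i\wedge\mathbf z$, $\delta_3(\mathbf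 z)=0$. In each case let $\mathfrak g=\mathfrak h^*$, with basis $\mathbf p_i,\mathbf q_i,\mathbf r$ dual to $\mathbf x_i,\mathbf y_i,\mathbf z$. Equip it with the bracket $\langle[\mu,\nu],X\rangle=\langle\mu\otimes\nu,\delta(X)\rangle$ and with the cobracket $\theta:\mathfrak g\to\mathfrak g\wedge\mathfrak g$, $\langle\theta(\mu),X\otimes Y\rangle=\langle\mu,[X,Y]\rangle$. For $p,q\in\mathbb R^n$ and $r\in\mathbb R$ identify $(p,q,r)$ with $\sum_i p_i\mathbf p_i+\sum_i q_i\mathbf q_i+r\mathbf r$; thus $\mathbb R^{2n+1}\cong\mathfrak g$, and a covector at a point of $\mathbb R^{2n+1}$ is an element $(x,y,z)=\sum_i x_i\mathbf x_i+\sum_i y_i\mathbf y_i+z\mathbf z$ of $\mathfrak h$. Let $G$ be $\mathbb R^{2n+1}$ with the multiplication 1. $(p,q,r)(p',q',r')=(e^{\lambda r'}p+p',\,e^{-\lambda r'}q+q',\,r+r')$; 2. $(p,q,r)(p',q',r')=(e^{\lambda r'}p+p',\,e^{\lambda r'}q+q',\,r+r')$; 3. $(p,q,r)(p',q',r')=\bigl(p+p',\,q+q'+r'\sum_{i,j}J_{ij}p_i\mathbf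 q_j,\,r+r'\bigr)$, respectively. Then, in each of the three cases: * $G$ is a simply connected Lie group, and the identification $T_eG=\mathbb R^{2n+1}\cong\mathfrak g$ is an isomorphism from the Lie algebra of $G$ (left-invariant vector fields) onto $\mathfrak g$ with the bracket dual to $\delta$. * There is exactly one Poisson bracket on $C^\infty(G)$ which makes $G$ a Poisson–Lie group (the multiplication $G\times G\to G$ is a Poisson map) and whose linearization at the identity is $\theta$, that is, $d_e\{\phi,\psi\}(v)=\langle\theta(v),d_e\phi\otimes d_e\psi\rangle$ for $v\in T_eG$. * There is exactly one smooth $F:G\to\mathfrak g\wedge\mathfrak g$ with $F(gh)=F(g)+\operatorname{Ad}_g F(h)$ for all $g,h\in G$ and $dF_e=\theta$, and the Poisson bracket is the right translation of $F$: $\{\phi,\psi\}(g)=\langle (R_g)_*F(g),d\phi(g)\otimes d\psi(g)\rangle$. * For $\phi,\psi\in C^\infty(G)$, with $d\phi(p,q,r)=(x,y,z)$ and $d\psi(p,q,r)=(x',y',z')$, the Poisson bracket is, respectively, 1. $\{\phi,\psi\}(p,q,r)=r\bigl(\beta(x,y')-\beta(x',y)\bigr)$; 2. $\{\phi,\psi\}(p,q,r)=\dfrac{e^{2\lambda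 r}-1}{2\lambda}\bigl(\beta(x,y')-\beta(x',y)\bigr)$; 3. $\{\phi,\psi\}(p,q,r)=r\bigl(\beta(x,y')-\beta(x',y)\bigr)+\dfrac{r^2}{2}\sum_{k,j=1}^n J_{kj}(y_jy'_k-y_ky'_j)$. -/

import Mathlib

open scoped Manifold ContDiff TensorProduct

noncomputable section

namespace HeisenbergDual

/-! ### Duals of Lie algebras and of cobrackets -/

section Dual

variable {V : Type*} [AddCommGroup V] [Module ℝ V]

/-- `u ∧ v = u ⊗ v - v ⊗ u`. -/
def wedge (u v : V) : V ⊗[ℝ] V := u ⊗ₜ[ℝ] v - v ⊗ₜ[ℝ] u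

/-- The bracket on `V*` dual to a cobracket `δ : V → V ⊗ V`: `⟨[μ, ν], X⟩ = ⟨μ ⊗ ν, δ X⟩`. -/
def dualBracket (δ : V →ₗ[ℝ] V ⊗[ℝ] V) (μ ν : Module.Dual ℝ V) : Module.Dual ℝ V :=
  TensorProduct.dualDistrib ℝ V V (μ ⊗ₜ[ℝ] ν) ∘ₗ δ

/-- The cobracket `θ : V* → V* ⊗ V*` dual to the bracket of a finite-dimensional Lie algebra `V`:
`⟨θ μ, X ⊗ Y⟩ = ⟨μ, [X, Y]⟩`. -/
def dualCobracket (V : Type*) [LieRing V] [LieAlgebra ℝ V] [Module.Finite ℝ V] :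
    Module.Dual ℝ V →ₗ[ℝ] Module.Dual ℝ V ⊗[ℝ] Module.Dual ℝ V :=
  (TensorProduct.dualDistribEquiv ℝ V V).symm.toLinearMap ∘ₗ
    (LieModule.toModuleHom ℝ V V : V ⊗[ℝ] V →ₗ[ℝ] V).dualMap

theorem dualDistrib_dualCobracket (V : Type*) [LieRing V] [LieAlgebra ℝ V] [Module.Finite ℝ V]
    (μ : Module.Dual ℝ V) (X Y : V) :
    TensorProduct.dualDistrib ℝ V V (dualCobracket V μ) (X ⊗ₜ[ℝ] Y) = μ ⁅X, Y⁆ := by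
  have h : TensorProduct.dualDistrib ℝ V V (dualCobracket V μ) =
      (LieModule.toModuleHom ℝ V V : V ⊗[ℝ] V →ₗ[ℝ] V).dualMap μ :=
    (TensorProduct.dualDistribEquiv ℝ V V).apply_symm_apply _
  rw [h]
  simp

end Dual

/-! ### Poisson brackets, Poisson–Lie groups, group cocycles -/

section LieGroups

variable {E : Type*} [NormedAddCommGroup E] [NormedSpace ℝ E]
  {G : Type*} [TopologicalSpace G] [ChartedSpace E G]

/-- The differential `dφ(g)`, a covector at `g`. -/
def differential (φ : C^∞⟮𝓘(ℝ, E), G; ℝ⟯) (g : G) :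
    Module.Dual ℝ (TangentSpace 𝓘(ℝ, E) g) :=
  (mfderiv 𝓘(ℝ, E) 𝓘(ℝ, ℝ) φ g : TangentSpace 𝓘(ℝ, E) g →L[ℝ] ℝ).toLinearMap

/-- A Poisson bracket on the algebra of smooth functions of a manifold. -/
structure IsPoissonBracket
    (B : C^∞⟮𝓘(ℝ, E), G; ℝ⟯ → C^∞⟮𝓘(ℝ, E), G; ℝ⟯ → C^∞⟮𝓘(ℝ, E), G; ℝ⟯) : Prop where
  add_left : ∀ φ φ' ψ, B (φ + φ') ψ = B φ ψ + B φ' ψ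
  smul_left : ∀ (c : ℝ) φ ψ, B (c • φ) ψ = c • B φ ψ
  skew : ∀ φ ψ, B φ ψ = - B ψ φ
  leibniz : ∀ φ ψ χ, B φ (ψ * χ) = B φ ψ * χ + ψ * B φ χ
  jacobi : ∀ φ ψ χ, B φ (B ψ χ) + B ψ (B χ φ) + B χ (B φ ψ) = 0

variable [Group G]

/-- `(G, B)` is a Poisson–Lie group: `B` is a Poisson bracket, and the multiplication `G × G → G`
is a Poisson map for the product Poisson structure, that is
`{φ, ψ}(gh) = {φ ∘ R_h, ψ ∘ R_h}(g) + {φ ∘ L_g, ψ ∘ L_g}(h)`. -/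
structure IsPoissonLie [LieGroup 𝓘(ℝ, E) ∞ G]
    (B : C^∞⟮𝓘(ℝ, E), G; ℝ⟯ → C^∞⟮𝓘(ℝ, E), G; ℝ⟯ → C^∞⟮𝓘(ℝ, E), G; ℝ⟯) : Prop
    extends IsPoissonBracket B where
  multiplicative : ∀ φ ψ (g h : G),
    B φ ψ (g * h) =
      B (φ.comp (smoothRightMul 𝓘(ℝ, E) h)) (ψ.comp (smoothRightMul 𝓘(ℝ, E) h)) g +
      B (φ.comp (smoothLeftMul 𝓘(ℝ, E) g)) (ψ.comp (smoothLeftMul 𝓘(ℝ, E) g)) h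

/-- The cobracket `θ` on the Lie algebra of `G` is the linearization of `B` at the identity:
`d_e{φ, ψ}(v) = ⟨θ v, d_eφ ⊗ d_eψ⟩`. -/
def IsLinearization
    (B : C^∞⟮𝓘(ℝ, E), G; ℝ⟯ → C^∞⟮𝓘(ℝ, E), G; ℝ⟯ → C^∞⟮𝓘(ℝ, E), G; ℝ⟯)
    (θ : GroupLieAlgebra 𝓘(ℝ, E) G →ₗ[ℝ]
      GroupLieAlgebra 𝓘(ℝ, E) G ⊗[ℝ] GroupLieAlgebra 𝓘(ℝ, E) G) : Prop :=
  ∀ φ ψ v, differential (B φ ψ) 1 v =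
    TensorProduct.dualDistrib ℝ _ _ (differential φ (1 : G) ⊗ₜ[ℝ] differential ψ (1 : G)) (θ v)

/-- The adjoint representation: `Ad g` is the derivative at the identity of `a ↦ g a g⁻¹`. -/
def Ad (g : G) : GroupLieAlgebra 𝓘(ℝ, E) G →ₗ[ℝ] GroupLieAlgebra 𝓘(ℝ, E) G :=
  (mfderiv 𝓘(ℝ, E) 𝓘(ℝ, E) (fun a : G => g * a * g⁻¹) 1 : E →L[ℝ] E).toLinearMap

/-- The derivative at the identity of the right translation `R_g : a ↦ a g`. -/
def rightTranslation (g : G) : GroupLieAlgebra 𝓘(ℝ, E) G →ₗ[ℝ] TangentSpace 𝓘(ℝ, E) g :=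
  (mfderiv 𝓘(ℝ, E) 𝓘(ℝ, E) (fun a : G => a * g) 1 : E →L[ℝ] E).toLinearMap

/-- `F` is a smooth group 1-cocycle with values in the skew 2-tensors over the Lie algebra, for the
representation `Ad`, whose derivative at the identity is `θ`. Smoothness and the derivative are
expressed through the components `⟨F, ξ ⊗ η⟩`. -/
structure IsIntegratingCocycle
    (θ : GroupLieAlgebra 𝓘(ℝ, E) G →ₗ[ℝ]
      GroupLieAlgebra 𝓘(ℝ, E) G ⊗[ℝ] GroupLieAlgebra 𝓘(ℝ, E) G)
    (F : G → GroupLieAlgebra 𝓘(ℝ, E) G ⊗[ℝ] GroupLieAlgebra 𝓘(ℝ, E) G) : Prop where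
  smooth : ∀ ξ η : Module.Dual ℝ (GroupLieAlgebra 𝓘(ℝ, E) G),
    ContMDiff 𝓘(ℝ, E) 𝓘(ℝ, ℝ) ∞
      (fun g => TensorProduct.dualDistrib ℝ _ _ (ξ ⊗ₜ[ℝ] η) (F g))
  skew : ∀ g, TensorProduct.comm ℝ _ _ (F g) = - F g
  cocycle : ∀ g h, F (g * h) = F g + TensorProduct.map (Ad g) (Ad g) (F h)
  deriv_one : ∀ (ξ η : Module.Dual ℝ (GroupLieAlgebra 𝓘(ℝ, E) G))
      (v : GroupLieAlgebra 𝓘(ℝ, E) G),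
    mfderiv 𝓘(ℝ, E) 𝓘(ℝ, ℝ)
      (fun g => TensorProduct.dualDistrib ℝ _ _ (ξ ⊗ₜ[ℝ] η) (F g)) 1 v =
      TensorProduct.dualDistrib ℝ _ _ (ξ ⊗ₜ[ℝ] η) (θ v)

/-- `B` is given by the bivector field which is the right translation of `F`:
`{φ, ψ}(g) = ⟨(R_g)_* F(g), dφ(g) ⊗ dψ(g)⟩`. -/
def IsRightTranslate
    (F : G → GroupLieAlgebra 𝓘(ℝ, E) G ⊗[ℝ] GroupLieAlgebra 𝓘(ℝ, E) G)
    (B : C^∞⟮𝓘(ℝ, E), G; ℝ⟯ → C^∞⟮𝓘(ℝ, E), G; ℝ⟯ → C^∞⟮𝓘(ℝ, E), G; ℝ⟯) : Prop :=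
  ∀ φ ψ g, B φ ψ g =
    TensorProduct.dualDistrib ℝ _ _ (differential φ g ⊗ₜ[ℝ] differential ψ g)
      (TensorProduct.map (rightTranslation g) (rightTranslation g) (F g))

/-- The Lie group `G`, with `ι : Lie(G) ≃ V*`, is the simply connected Lie group corresponding to
the Lie algebra `V*` with the bracket dual to `δ`. -/
structure IsDualLieGroup {V : Type*} [AddCommGroup V] [Module ℝ V] (δ : V →ₗ[ℝ] V ⊗[ℝ] V)
    (ι : GroupLieAlgebra 𝓘(ℝ, E) G ≃ₗ[ℝ] Module.Dual ℝ V) : Prop where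
  lieGroup : LieGroup 𝓘(ℝ, E) ∞ G
  simplyConnected : SimplyConnectedSpace G
  map_lie : ∀ v w : GroupLieAlgebra 𝓘(ℝ, E) G, ι ⁅v, w⁆ = dualBracket δ (ι v) (ι w)

/-- The cobracket on `Lie(G) ≃ V*` dual to the bracket of the Lie algebra `V`. -/
def groupCobracket {V : Type*} [LieRing V] [LieAlgebra ℝ V] [Module.Finite ℝ V]
    (ι : GroupLieAlgebra 𝓘(ℝ, E) G ≃ₗ[ℝ] Module.Dual ℝ V) :
    GroupLieAlgebra 𝓘(ℝ, E) G →ₗ[ℝ]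
      GroupLieAlgebra 𝓘(ℝ, E) G ⊗[ℝ] GroupLieAlgebra 𝓘(ℝ, E) G :=
  TensorProduct.map ι.symm.toLinearMap ι.symm.toLinearMap ∘ₗ dualCobracket V ∘ₗ ι.toLinearMap

end LieGroups

/-! ### The Heisenberg Lie algebra and its three cobrackets -/

/-- The vector space `ℝⁿ × ℝⁿ × ℝ`. -/
abbrev Vec (n : ℕ) : Type := (Fin n → ℝ) × (Fin n → ℝ) × ℝ

/-- The Heisenberg Lie algebra, with elements `(x, y, z)`. -/
def Heis (n : ℕ) : Type := Vec n

namespace Heis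

variable {n : ℕ}

instance : AddCommGroup (Heis n) := inferInstanceAs (AddCommGroup (Vec n))
instance : Module ℝ (Heis n) := inferInstanceAs (Module ℝ (Vec n))
instance : Module.Finite ℝ (Heis n) := inferInstanceAs (Module.Finite ℝ (Vec n))

def mk (x y : Fin n → ℝ) (z : ℝ) : Heis n := (x, y, z)
def x (X : Heis n) : Fin n → ℝ := Prod.fst (α := Fin n → ℝ) (β := (Fin n → ℝ) × ℝ) X
def y (X : Heis n) : Fin n → ℝ :=
  Prod.fst (β := ℝ) (Prod.snd (α := Fin n → ℝ) (β := (Fin n → ℝ) × ℝ) X)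
def z (X : Heis n) : ℝ :=
  Prod.snd (α := Fin n → ℝ) (Prod.snd (α := Fin n → ℝ) (β := (Fin n → ℝ) × ℝ) X)

@[simp] theorem x_mk (a b : Fin n → ℝ) (c : ℝ) : (mk a b c).x = a := rfl
@[simp] theorem y_mk (a b : Fin n → ℝ) (c : ℝ) : (mk a b c).y = b := rfl
@[simp] theorem z_mk (a b : Fin n → ℝ) (c : ℝ) : (mk a b c).z = c := rfl
@[simp] theorem x_add (X Y : Heis n) : (X + Y).x = X.x + Y.x := rfl
@[simp] theorem y_add (X Y : Heis n) : (X + Y).y = X.y + Y.y := rfl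
@[simp] theorem z_add (X Y : Heis n) : (X + Y).z = X.z + Y.z := rfl
@[simp] theorem x_smul (c : ℝ) (X : Heis n) : (c • X).x = c • X.x := rfl
@[simp] theorem y_smul (c : ℝ) (X : Heis n) : (c • X).y = c • X.y := rfl
@[simp] theorem z_smul (c : ℝ) (X : Heis n) : (c • X).z = c • X.z := rfl
@[simp] theorem x_zero : (0 : Heis n).x = 0 := rfl
@[simp] theorem y_zero : (0 : Heis n).y = 0 := rfl
@[simp] theorem z_zero : (0 : Heis n).z = 0 := rfl

@[ext] theorem ext {X Y : Heis n} (hx : X.x = Y.x) (hy : X.y = Y.y) (hz : X.z = Y.z) : X = Y :=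
  Prod.ext hx (Prod.ext hy hz)

/-- `[(x, y, z), (x', y', z')] = (0, 0, β(x, y') - β(x', y))`, i.e. `[𝐱ᵢ, 𝐲ⱼ] = δᵢⱼ 𝐳` with `𝐳`
central and all other brackets of basis vectors zero. -/
instance : Bracket (Heis n) (Heis n) := ⟨fun X Y => mk 0 0 (X.x ⬝ᵥ Y.y - Y.x ⬝ᵥ X.y)⟩

theorem lie_def (X Y : Heis n) : ⁅X, Y⁆ = mk 0 0 (X.x ⬝ᵥ Y.y - Y.x ⬝ᵥ X.y) := rfl

instance : LieRing (Heis n) where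
  add_lie X Y Z := by
    ext <;> simp [lie_def, add_dotProduct, dotProduct_add]
    ring
  lie_add X Y Z := by
    ext <;> simp [lie_def, add_dotProduct, dotProduct_add]
    ring
  lie_self X := by ext <;> simp [lie_def]
  leibniz_lie X Y Z := by ext <;> simp [lie_def]

instance : LieAlgebra ℝ (Heis n) where
  lie_smul c X Y := by
    ext <;> simp [lie_def]
    ring

/-- The basis vector `𝐱ᵢ`. -/
def eX (i : Fin n) : Heis n := mk (Pi.single i 1) 0 0
/-- The basis vector `𝐲ᵢ`. -/
def eY (i : Fin n) : Heis n := mk 0 (Pi.single i 1) 0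
/-- The basis vector `𝐳`. -/
def eZ : Heis n := mk 0 0 1

/-- The linear map on the Heisenberg Lie algebra with prescribed values `a i`, `b i`, `c` on the
basis vectors `𝐱ᵢ`, `𝐲ᵢ`, `𝐳`. -/
def lift {W : Type*} [AddCommGroup W] [Module ℝ W] (a b : Fin n → W) (c : W) :
    Heis n →ₗ[ℝ] W where
  toFun X := ∑ i, X.x i • a i + ∑ i, X.y i • b i + X.z • c
  map_add' X Y := by
    simp only [x_add, y_add, z_add, Pi.add_apply, add_smul, Finset.sum_add_distrib]
    abel
  map_smul' r X := by
    simp [Finset.smul_sum, smul_smul]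

@[simp] theorem lift_apply {W : Type*} [AddCommGroup W] [Module ℝ W] (a b : Fin n → W) (c : W)
    (X : Heis n) :
    lift a b c X = ∑ i, X.x i • a i + ∑ i, X.y i • b i + X.z • c := rfl

section
variable {W : Type*} [AddCommGroup W] [Module ℝ W] (a b : Fin n → W) (c : W)

theorem lift_eX (i : Fin n) : lift a b c (eX i) = a i := by
  simp [eX, Pi.single_apply]

theorem lift_eY (i : Fin n) : lift a b c (eY i) = b i := by
  simp [eY, Pi.single_apply]

theorem lift_eZ : lift a b c eZ = c := by
  simp [eZ]

end

theorem eq_sum (X : Heis n) :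
    X = ∑ i, X.x i • eX i + ∑ i, X.y i • eY i + X.z • eZ := by
  have hx : ∀ f : Fin n → Heis n, (∑ i, f i).x = ∑ i, (f i).x := fun f =>
    map_sum (⟨⟨x, x_zero⟩, x_add⟩ : Heis n →+ (Fin n → ℝ)) f _
  have hy : ∀ f : Fin n → Heis n, (∑ i, f i).y = ∑ i, (f i).y := fun f =>
    map_sum (⟨⟨y, y_zero⟩, y_add⟩ : Heis n →+ (Fin n → ℝ)) f _
  have hz : ∀ f : Fin n → Heis n, (∑ i, f i).z = ∑ i, (f i).z := fun f =>
    map_sum (⟨⟨z, z_zero⟩, z_add⟩ : Heis n →+ ℝ) f _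
  ext <;> simp [hx, hy, hz, eX, eY, eZ, Finset.sum_apply, Pi.single_apply]

/-- `δ₁(𝐱ⱼ) = λ 𝐱ⱼ ∧ 𝐳`, `δ₁(𝐲ⱼ) = -λ 𝐲ⱼ ∧ 𝐳`, `δ₁(𝐳) = 0`. -/
def cobracket₁ (n : ℕ) (lam : ℝ) : Heis n →ₗ[ℝ] Heis n ⊗[ℝ] Heis n :=
  lift (fun j => lam • wedge (eX j) eZ) (fun j => -(lam • wedge (eY j) eZ)) 0

/-- `δ₂(𝐱ⱼ) = λ 𝐱ⱼ ∧ 𝐳`, `δ₂(𝐲ⱼ) = λ 𝐲ⱼ ∧ 𝐳`, `δ₂(𝐳) = 0`. -/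
def cobracket₂ (n : ℕ) (lam : ℝ) : Heis n →ₗ[ℝ] Heis n ⊗[ℝ] Heis n :=
  lift (fun j => lam • wedge (eX j) eZ) (fun j => lam • wedge (eY j) eZ) 0

/-- `δ₃(𝐱ⱼ) = 0`, `δ₃(𝐲ⱼ) = ∑ᵢ Jᵢⱼ 𝐱ᵢ ∧ 𝐳`, `δ₃(𝐳) = 0`. -/
def cobracket₃ {n : ℕ} (J : Matrix (Fin n) (Fin n) ℝ) : Heis n →ₗ[ℝ] Heis n ⊗[ℝ] Heis n :=
  lift 0 (fun j => ∑ i, J i j • wedge (eX i) eZ) 0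

end Heis

/-- The identification of `ℝⁿ × ℝⁿ × ℝ` with the dual of the Heisenberg Lie algebra, where
`(p, q, r)` stands for `∑ pᵢ 𝐩ᵢ + ∑ qᵢ 𝐪ᵢ + r 𝐫` and `𝐩ᵢ, 𝐪ᵢ, 𝐫` is the basis dual to
`𝐱ᵢ, 𝐲ᵢ, 𝐳`: `⟨(p, q, r), (x, y, z)⟩ = p · x + q · y + r z`. -/
def coord (n : ℕ) : Vec n ≃ₗ[ℝ] Module.Dual ℝ (Heis n) where
  toFun v := Heis.lift v.1 v.2.1 v.2.2
  invFun μ := (fun i => μ (Heis.eX i), fun i => μ (Heis.eY i), μ Heis.eZ)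
  map_add' v w := by
    ext X
    simp [mul_add, Finset.sum_add_distrib]
    ring
  map_smul' c v := by
    ext X
    simp [mul_add, Finset.mul_sum, mul_left_comm]
  left_inv v := by
    ext <;> simp only [Heis.lift_eX, Heis.lift_eY, Heis.lift_eZ]
  right_inv μ := by
    ext X
    conv_rhs => rw [Heis.eq_sum X]
    simp

theorem coord_apply {n : ℕ} (v : Vec n) (X : Heis n) :
    coord n v X = v.1 ⬝ᵥ X.x + v.2.1 ⬝ᵥ X.y + v.2.2 * X.z := by
  simp [coord, dotProduct, mul_comm]

/-- A covector `ξ` on `ℝⁿ × ℝⁿ × ℝ`, the dual of the Heisenberg Lie algebra, viewed as an element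
`(x, y, z)` of the Heisenberg Lie algebra. -/
def toHeis {n : ℕ} (ξ : Module.Dual ℝ (Vec n)) : Heis n :=
  Heis.mk (fun i => ξ (Pi.single i 1, 0, 0)) (fun i => ξ (0, Pi.single i 1, 0)) (ξ (0, 0, 1))

theorem coord_toHeis {n : ℕ} (v : Vec n) (ξ : Module.Dual ℝ (Vec n)) :
    coord n v (toHeis ξ) = ξ v := by
  obtain ⟨p, q, r⟩ := v
  have aux : ∀ i : Fin n, (fun j => if i = j then (1 : ℝ) else 0) = Pi.single i 1 := by
    intro i
    ext j
    simp [Pi.single_apply, eq_comm]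
  have h1 : ξ (p, 0, 0) = ∑ i, p i * ξ (Pi.single i 1, 0, 0) := by
    have := (ξ ∘ₗ LinearMap.inl ℝ (Fin n → ℝ) ((Fin n → ℝ) × ℝ)).pi_apply_eq_sum_univ p
    exact this.trans (Finset.sum_congr rfl fun i _ => by rw [aux]; rfl)
  have h2 : ξ (0, q, 0) = ∑ i, q i * ξ (0, Pi.single i 1, 0) := by
    have := (ξ ∘ₗ LinearMap.inr ℝ (Fin n → ℝ) ((Fin n → ℝ) × ℝ) ∘ₗ
      LinearMap.inl ℝ (Fin n → ℝ) ℝ).pi_apply_eq_sum_univ q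
    exact this.trans (Finset.sum_congr rfl fun i _ => by rw [aux]; rfl)
  have h3 : ξ (0, 0, r) = r * ξ (0, 0, 1) := by
    have : ((0, 0, r) : Vec n) = r • (0, 0, 1) := by simp
    rw [this, map_smul, smul_eq_mul]
  have h : ((p, q, r) : Vec n) = (p, 0, 0) + (0, q, 0) + (0, 0, r) := by simp
  rw [h, map_add, map_add, map_add, map_add, LinearMap.add_apply, LinearMap.add_apply,
    h1, h2, h3]
  simp [coord_apply, toHeis, dotProduct]

/-! ### The three groups -/

/-- `ℝⁿ × ℝⁿ × ℝ` with the multiplication of the first group. -/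
def Group₁ (n : ℕ) (_lam : ℝ) : Type := Vec n

/-- `ℝⁿ × ℝⁿ × ℝ` with the multiplication of the second group. -/
def Group₂ (n : ℕ) (_lam : ℝ) : Type := Vec n

/-- `ℝⁿ × ℝⁿ × ℝ` with the multiplication of the third group. -/
def Group₃ {n : ℕ} (_J : Matrix (Fin n) (Fin n) ℝ) : Type := Vec n

section Charts

variable {n : ℕ} {lam : ℝ} {J : Matrix (Fin n) (Fin n) ℝ}

instance : TopologicalSpace (Group₁ n lam) := inferInstanceAs (TopologicalSpace (Vec n))
instance : TopologicalSpace (Group₂ n lam) := inferInstanceAs (TopologicalSpace (Vec n))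
instance : TopologicalSpace (Group₃ J) := inferInstanceAs (TopologicalSpace (Vec n))

/-- The manifold structure of the vector space: the identity is the only chart. -/
instance : ChartedSpace (Vec n) (Group₁ n lam) := chartedSpaceSelf (Vec n)
/-- The manifold structure of the vector space: the identity is the only chart. -/
instance : ChartedSpace (Vec n) (Group₂ n lam) := chartedSpaceSelf (Vec n)
/-- The manifold structure of the vector space: the identity is the only chart. -/
instance : ChartedSpace (Vec n) (Group₃ J) := chartedSpaceSelf (Vec n)

instance : IsManifold 𝓘(ℝ, Vec n) ∞ (Group₁ n lam) :=
  instIsManifoldModelSpace (I := 𝓘(ℝ, Vec n))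
instance : IsManifold 𝓘(ℝ, Vec n) ∞ (Group₂ n lam) :=
  instIsManifoldModelSpace (I := 𝓘(ℝ, Vec n))
instance : IsManifold 𝓘(ℝ, Vec n) ∞ (Group₃ J) :=
  instIsManifoldModelSpace (I := 𝓘(ℝ, Vec n))

theorem contMDiff_uncurry {F : Type*} [NormedAddCommGroup F] [NormedSpace ℝ F] (f : F × F → F)
    (hf : ContDiff ℝ ∞ f) : ContMDiff (𝓘(ℝ, F).prod 𝓘(ℝ, F)) 𝓘(ℝ, F) ∞ f := by
  rw [← modelWithCornersSelf_prod, chartedSpaceSelf_prod]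
  exact contMDiff_iff_contDiff.2 hf

theorem contMDiff_of_contDiff {F : Type*} [NormedAddCommGroup F] [NormedSpace ℝ F] (f : F → F)
    (hf : ContDiff ℝ ∞ f) : ContMDiff 𝓘(ℝ, F) 𝓘(ℝ, F) ∞ f :=
  contMDiff_iff_contDiff.2 hf

end Charts

namespace Group₁

variable {n : ℕ} {lam : ℝ}

/-- The element of the group with coordinates `(p, q, r)`. -/
def mk (p q : Fin n → ℝ) (r : ℝ) : Group₁ n lam := ((p, q, r) : Vec n)

/-- `(p, q, r)(p', q', r') = (e^{λr'} p + p', e^{-λr'} q + q', r + r')`. -/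
def mulFun (lam : ℝ) (a b : Vec n) : Vec n :=
  (Real.exp (lam * b.2.2) • a.1 + b.1, Real.exp (-(lam * b.2.2)) • a.2.1 + b.2.1, a.2.2 + b.2.2)

def invFun (lam : ℝ) (a : Vec n) : Vec n :=
  (-(Real.exp (-(lam * a.2.2)) • a.1), -(Real.exp (lam * a.2.2) • a.2.1), -a.2.2)

theorem mulFun_assoc (a b c : Vec n) :
    mulFun lam (mulFun lam a b) c = mulFun lam a (mulFun lam b c) := by
  simp only [mulFun, smul_add, smul_smul, ← Real.exp_add]
  ext <;> simp <;> ring_nf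

theorem mulFun_zero_left (a : Vec n) : mulFun lam 0 a = a := by
  simp [mulFun]

theorem mulFun_zero_right (a : Vec n) : mulFun lam a 0 = a := by
  simp [mulFun]

theorem mulFun_inv (a : Vec n) : mulFun lam (invFun lam a) a = 0 := by
  simp [mulFun, invFun, smul_smul, ← Real.exp_add]

instance : Group (Group₁ n lam) where
  mul a b := mulFun lam a b
  one := (0 : Vec n)
  inv a := invFun lam a
  mul_assoc a b c := mulFun_assoc a b c
  one_mul a := mulFun_zero_left a
  mul_one a := mulFun_zero_right a
  inv_mul_cancel a := mulFun_inv a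

theorem mk_mul_mk (p q p' q' : Fin n → ℝ) (r r' : ℝ) :
    (mk p q r * mk p' q' r' : Group₁ n lam) =
      mk (Real.exp (lam * r') • p + p') (Real.exp (-(lam * r')) • q + q') (r + r') := rfl

instance : LieGroup 𝓘(ℝ, Vec n) ∞ (Group₁ n lam) where
  contMDiff_mul := contMDiff_uncurry (fun x => mulFun lam x.1 x.2) (by
    unfold mulFun; fun_prop)
  contMDiff_inv := contMDiff_of_contDiff (invFun lam) (by
    unfold invFun; fun_prop)

end Group₁

namespace Group₂

variable {n : ℕ} {lam : ℝ}

/-- The element of the group with coordinates `(p, q, r)`. -/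
def mk (p q : Fin n → ℝ) (r : ℝ) : Group₂ n lam := ((p, q, r) : Vec n)

/-- `(p, q, r)(p', q', r') = (e^{λr'} p + p', e^{λr'} q + q', r + r')`. -/
def mulFun (lam : ℝ) (a b : Vec n) : Vec n :=
  (Real.exp (lam * b.2.2) • a.1 + b.1, Real.exp (lam * b.2.2) • a.2.1 + b.2.1, a.2.2 + b.2.2)

def invFun (lam : ℝ) (a : Vec n) : Vec n :=
  (-(Real.exp (-(lam * a.2.2)) • a.1), -(Real.exp (-(lam * a.2.2)) • a.2.1), -a.2.2)

theorem mulFun_assoc (a b c : Vec n) :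
    mulFun lam (mulFun lam a b) c = mulFun lam a (mulFun lam b c) := by
  simp only [mulFun, smul_add, smul_smul, ← Real.exp_add]
  ext <;> simp <;> ring_nf

theorem mulFun_zero_left (a : Vec n) : mulFun lam 0 a = a := by
  simp [mulFun]

theorem mulFun_zero_right (a : Vec n) : mulFun lam a 0 = a := by
  simp [mulFun]

theorem mulFun_inv (a : Vec n) : mulFun lam (invFun lam a) a = 0 := by
  simp [mulFun, invFun, smul_smul, ← Real.exp_add]

instance : Group (Group₂ n lam) where
  mul a b := mulFun lam a b
  one := (0 : Vec n)
  inv a := invFun lam a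
  mul_assoc a b c := mulFun_assoc a b c
  one_mul a := mulFun_zero_left a
  mul_one a := mulFun_zero_right a
  inv_mul_cancel a := mulFun_inv a

theorem mk_mul_mk (p q p' q' : Fin n → ℝ) (r r' : ℝ) :
    (mk p q r * mk p' q' r' : Group₂ n lam) =
      mk (Real.exp (lam * r') • p + p') (Real.exp (lam * r') • q + q') (r + r') := rfl

instance : LieGroup 𝓘(ℝ, Vec n) ∞ (Group₂ n lam) where
  contMDiff_mul := contMDiff_uncurry (fun x => mulFun lam x.1 x.2) (by
    unfold mulFun; fun_prop)
  contMDiff_inv := contMDiff_of_contDiff (invFun lam) (by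
    unfold invFun; fun_prop)

end Group₂

namespace Group₃

variable {n : ℕ} {J : Matrix (Fin n) (Fin n) ℝ}

/-- The element of the group with coordinates `(p, q, r)`. -/
def mk (p q : Fin n → ℝ) (r : ℝ) : Group₃ J := ((p, q, r) : Vec n)

/-- `(p, q, r)(p', q', r') = (p + p', q + q' + r' ∑ᵢⱼ Jᵢⱼ pᵢ 𝐪ⱼ, r + r')`. -/
def mulFun (J : Matrix (Fin n) (Fin n) ℝ) (a b : Vec n) : Vec n :=
  (a.1 + b.1, fun j => a.2.1 j + b.2.1 j + b.2.2 * ∑ i, J i j * a.1 i, a.2.2 + b.2.2)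

def invFun (J : Matrix (Fin n) (Fin n) ℝ) (a : Vec n) : Vec n :=
  (-a.1, fun j => -a.2.1 j + a.2.2 * -∑ i, J i j * -a.1 i, -a.2.2)

theorem mulFun_assoc (a b c : Vec n) :
    mulFun J (mulFun J a b) c = mulFun J a (mulFun J b c) := by
  ext j <;> simp [mulFun, mul_add, add_mul, Finset.sum_add_distrib] <;> ring

theorem mulFun_zero_left (a : Vec n) : mulFun J 0 a = a := by
  simp [mulFun]

theorem mulFun_zero_right (a : Vec n) : mulFun J a 0 = a := by
  simp [mulFun]

theorem mulFun_inv (a : Vec n) : mulFun J (invFun J a) a = 0 := by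
  ext j <;> simp [mulFun, invFun]

instance : Group (Group₃ J) where
  mul a b := mulFun J a b
  one := (0 : Vec n)
  inv a := invFun J a
  mul_assoc a b c := mulFun_assoc a b c
  one_mul a := mulFun_zero_left a
  mul_one a := mulFun_zero_right a
  inv_mul_cancel a := mulFun_inv a

theorem mk_mul_mk (p q p' q' : Fin n → ℝ) (r r' : ℝ) :
    (mk p q r * mk p' q' r' : Group₃ J) =
      mk (p + p') (fun j => q j + q' j + r' * ∑ i, J i j * p i) (r + r') := rfl

instance : LieGroup 𝓘(ℝ, Vec n) ∞ (Group₃ J) where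
  contMDiff_mul := contMDiff_uncurry (fun x => mulFun J x.1 x.2) (by
    unfold mulFun; fun_prop)
  contMDiff_inv := contMDiff_of_contDiff (invFun J) (by
    unfold invFun; fun_prop)

end Group₃

/-! ### Coordinates on the tangent and cotangent spaces of the groups -/

section Coordinates

variable (n : ℕ) (G : Type) [TopologicalSpace G] [ChartedSpace (Vec n) G]

/-- The identification of the Lie algebra `T_e G = ℝⁿ × ℝⁿ × ℝ` with the dual of the Heisenberg Lie
algebra. -/
def lieCoord [Group G] : GroupLieAlgebra 𝓘(ℝ, Vec n) G ≃ₗ[ℝ] Module.Dual ℝ (Heis n) :=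
  coord n

/-- The cobracket `θ` on the Lie algebra of `G` which is dual to the bracket of the Heisenberg Lie
algebra. -/
def theta [Group G] : GroupLieAlgebra 𝓘(ℝ, Vec n) G →ₗ[ℝ]
    GroupLieAlgebra 𝓘(ℝ, Vec n) G ⊗[ℝ] GroupLieAlgebra 𝓘(ℝ, Vec n) G :=
  groupCobracket (lieCoord n G)

variable {n G}

/-- The differential `dφ(g)` viewed as an element `(x, y, z)` of the Heisenberg Lie algebra. -/
def heisDifferential (φ : C^∞⟮𝓘(ℝ, Vec n), G; ℝ⟯) (g : G) : Heis n :=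
  toHeis (n := n) (differential φ g)

end Coordinates

end HeisenbergDual

end

/-!
The statement has a general half, valid for every Lie group structure on a finite-dimensional real
vector space `E`, and a computational half about three explicit groups.

*General half.* A Poisson bracket is a derivation in each argument, so by Hadamard's lemma
(`exists_contDiff_eq_add_apply_sub`) its value at `g` depends only on the differentials at `g`
(`IsPoissonBracket.eq_linearFun`): it is given by a bivector field `π`. If the bracket is
multiplicative, the right trivialization `F(g) = (R_{g⁻¹})_* π(g)` is a cocycle for `Ad`. As `π`
vanishes at the identity, `dF_e` is the linearization of the bracket
(`IsPoissonLie.isIntegratingCocycle`), and `π` is recovered from `F` by right translation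
(`IsPoissonLie.isRightTranslate`). A cocycle is determined by its derivative at the identity,
because the differential at `g` of a difference of two cocycles is a transform of the one at the
identity (`IsIntegratingCocycle.eq`). Hence a Poisson–Lie bracket with a given linearization is
unique (`IsPoissonLie.eq`), and so is the cocycle; what remains is to exhibit one bracket on each
group.

*Computational half.* The three multiplications have the common form
`(p, q, r)(p', q', r') = (s(r') p + p', t(r') q + q' + r' Jᵀ p, r + r')` (`twistedMul`). The bracket
comes from the bivector field `a(r) ∑ᵢ 𝐩ᵢ ∧ 𝐪ᵢ + b(r)/2 ∑ᵢⱼ Jᵢⱼ 𝐪ⱼ ∧ 𝐪ᵢ` (`sharpField`). Its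
coefficients are functions of `r`, along which it has no component, so the Jacobi identity reduces to
the symmetry of second derivatives (`isPoissonBracket_sharpBracket`). Multiplicativity amounts to the
functional equations `a(r + r') = s(r') t(r') a(r) + a(r')` and
`b(r + r') = t(r')² b(r) + 2 r' t(r') a(r) + b(r')`, the second one only if `J ≠ 0`
(`sharpField_twistedMul`). With `a'(0) = 1` and `b'(0) = 0` the linearization is `θ`
(`exists_isPoissonLie_twistedMul`). The solutions are `a = r`; `a = (e^{2λr} - 1) / 2λ`; and
`a = r`, `b = r²`.
-/

noncomputable section

namespace HeisenbergDual

/-! ### Hadamard's lemma -/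

section Hadamard

universe u

variable {E : Type u} [NormedAddCommGroup E] [NormedSpace ℝ E] [FiniteDimensional ℝ E]

theorem hasFDerivAt_intervalIntegral_of_contDiff {F : Type u} [NormedAddCommGroup F]
    [NormedSpace ℝ F] {f : E → ℝ → F} (hf : ContDiff ℝ 1 (fun p : E × ℝ => f p.1 p.2)) (x : E) :
    HasFDerivAt (fun x => ∫ t in (0 : ℝ)..1, f x t)
      (∫ t in (0 : ℝ)..1, fderiv ℝ (fun x => f x t) x) x := by
  have hdiff : ∀ t, Differentiable ℝ (fun x => f x t) := fun t =>
    (hf.comp (contDiff_id.prodMk contDiff_const)).differentiable one_ne_zero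
  have hcont : Continuous (fun p : E × ℝ => fderiv ℝ (fun x => f x p.2) p.1) := by
    have : ContDiff ℝ 1 (fun q : (E × ℝ) × E => f q.2 q.1.2) :=
      hf.comp (contDiff_snd.prodMk (contDiff_snd.comp contDiff_fst))
    exact (ContDiff.fderiv (f := fun (p : E × ℝ) (x : E) => f x p.2) (n := 0) this
      contDiff_fst (by simp)).continuous
  obtain ⟨C, hC⟩ := ((isCompact_closedBall x 1).prod
    (isCompact_Icc (a := (0 : ℝ)) (b := 1))).exists_bound_of_continuousOn hcont.continuousOn
  refine intervalIntegral.hasFDerivAt_integral_of_dominated_of_fderiv_le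
    (F' := fun x t => fderiv ℝ (fun x => f x t) x) (bound := fun _ => C)
    (Metric.closedBall_mem_nhds x one_pos) ?_ ?_ ?_ ?_ (by simp) ?_
  · refine Filter.Eventually.of_forall fun y => ?_
    exact (hf.continuous.comp (continuous_const.prodMk continuous_id)).aestronglyMeasurable
  · exact (hf.continuous.comp (continuous_const.prodMk continuous_id)).intervalIntegrable _ _
  · exact (hcont.comp (continuous_const.prodMk continuous_id)).aestronglyMeasurable
  · refine Filter.Eventually.of_forall fun t ht y hy => hC (y, t) ⟨hy, ?_⟩
    rw [Set.uIoc_of_le zero_le_one] at ht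
    exact ⟨ht.1.le, ht.2⟩
  · exact Filter.Eventually.of_forall fun t _ y _ => (hdiff t y).hasFDerivAt

/-- The derivative of a parametric integral is a parametric integral again, with values in another
space; so the target varies in the induction on `n`. -/
theorem contDiff_intervalIntegral_of_contDiff_nat (n : ℕ) :
    ∀ {F : Type u} [NormedAddCommGroup F] [NormedSpace ℝ F] {f : E → ℝ → F},
      ContDiff ℝ ∞ (fun p : E × ℝ => f p.1 p.2) →
      ContDiff ℝ n (fun x => ∫ t in (0 : ℝ)..1, f x t) := by
  induction n with
  | zero =>
    intro F _ _ f hf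
    have h := hasFDerivAt_intervalIntegral_of_contDiff (hf.of_le (by simp))
    exact contDiff_zero.2 (continuous_iff_continuousAt.2 fun x => (h x).continuousAt)
  | succ n ih =>
    intro F _ _ f hf
    have h := hasFDerivAt_intervalIntegral_of_contDiff (hf.of_le (by simp))
    push_cast
    refine contDiff_succ_iff_fderiv.2 ⟨fun x => (h x).differentiableAt, by simp, ?_⟩
    rw [funext fun x => (h x).fderiv]
    refine ih ?_
    have : ContDiff ℝ ∞ (fun q : (E × ℝ) × E => f q.2 q.1.2) :=
      hf.comp (contDiff_snd.prodMk (contDiff_snd.comp contDiff_fst))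
    exact ContDiff.fderiv (f := fun (p : E × ℝ) (x : E) => f x p.2) this contDiff_fst (by simp)

theorem contDiff_intervalIntegral_of_contDiff {F : Type u} [NormedAddCommGroup F]
    [NormedSpace ℝ F] {f : E → ℝ → F} (hf : ContDiff ℝ ∞ (fun p : E × ℝ => f p.1 p.2)) :
    ContDiff ℝ ∞ (fun x => ∫ t in (0 : ℝ)..1, f x t) :=
  contDiff_infty.2 fun n => contDiff_intervalIntegral_of_contDiff_nat n hf

/-- Hadamard's lemma: a smooth function vanishing at `g` is a combination of coordinate functions
vanishing at `g`, with smooth coefficients. -/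
theorem exists_contDiff_eq_add_apply_sub {f : E → ℝ} (hf : ContDiff ℝ ∞ f) (g : E) :
    ∃ k : E → E →L[ℝ] ℝ, ContDiff ℝ ∞ k ∧ (∀ x, f x = f g + k x (x - g)) ∧
      k g = fderiv ℝ f g := by
  have hf' : ContDiff ℝ ∞ (fderiv ℝ f) := (contDiff_infty_iff_fderiv.1 hf).2
  have hk : ContDiff ℝ ∞ (fun p : E × ℝ => fderiv ℝ f (g + p.2 • (p.1 - g))) := by fun_prop
  refine ⟨fun x => ∫ t in (0 : ℝ)..1, fderiv ℝ f (g + t • (x - g)),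
    contDiff_intervalIntegral_of_contDiff hk, fun x => ?_, by simp⟩
  have hc : Continuous fun t : ℝ => fderiv ℝ f (g + t • (x - g)) :=
    hf'.continuous.comp (by fun_prop)
  have hd : ∀ t : ℝ, HasDerivAt (fun t : ℝ => f (g + t • (x - g)))
      (fderiv ℝ f (g + t • (x - g)) (x - g)) t := fun t => by
    have h1 : HasDerivAt (fun t : ℝ => g + t • (x - g)) (x - g) t := by
      simpa using ((hasDerivAt_id t).smul_const (x - g)).const_add g
    exact ((hf.differentiable (by simp)) _).hasFDerivAt.comp_hasDerivAt t h1
  have h := intervalIntegral.integral_eq_sub_of_hasDerivAt (a := 0) (b := 1)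
    (fun t _ => hd t) ((hc.clm_apply continuous_const).intervalIntegrable _ _)
  rw [ContinuousLinearMap.intervalIntegral_apply (hc.intervalIntegrable _ _)]
  rw [h]
  simp

end Hadamard

/-! ### Pairings of 2-tensors with covectors -/

section Pairing

variable {V W : Type*} [AddCommGroup V] [Module ℝ V] [AddCommGroup W] [Module ℝ W]

theorem dualDistrib_map (f g : V →ₗ[ℝ] W) (ξ η : Module.Dual ℝ W) (t : V ⊗[ℝ] V) :
    TensorProduct.dualDistrib ℝ W W (ξ ⊗ₜ[ℝ] η) (TensorProduct.map f g t) =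
      TensorProduct.dualDistrib ℝ V V ((ξ ∘ₗ f) ⊗ₜ[ℝ] (η ∘ₗ g)) t := by
  induction t with
  | zero => simp
  | tmul u v => simp
  | add s t hs ht => simp only [map_add, hs, ht]

theorem dualDistrib_comm (ξ η : Module.Dual ℝ V) (t : V ⊗[ℝ] V) :
    TensorProduct.dualDistrib ℝ V V (ξ ⊗ₜ[ℝ] η) (TensorProduct.comm ℝ V V t) =
      TensorProduct.dualDistrib ℝ V V (η ⊗ₜ[ℝ] ξ) t := by
  induction t with
  | zero => simp
  | tmul u v => simp [mul_comm]
  | add s t hs ht => simp only [map_add, hs, ht]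

/-- A 2-tensor is determined by its components. -/
theorem ext_dualDistrib [Module.Finite ℝ V] {s t : V ⊗[ℝ] V}
    (h : ∀ ξ η : Module.Dual ℝ V, TensorProduct.dualDistrib ℝ V V (ξ ⊗ₜ[ℝ] η) s =
      TensorProduct.dualDistrib ℝ V V (ξ ⊗ₜ[ℝ] η) t) : s = t := by
  rw [← sub_eq_zero, ← Module.forall_dual_apply_eq_zero_iff ℝ]
  intro μ
  obtain ⟨m, rfl⟩ := (TensorProduct.dualDistribEquiv ℝ V V).surjective μ
  change TensorProduct.dualDistrib ℝ V V m (s - t) = 0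
  rw [map_sub, sub_eq_zero]
  induction m with
  | zero => simp
  | tmul u v => exact h u v
  | add a b ha hb => simp only [map_add, LinearMap.add_apply, ha, hb]

end Pairing

/-! ### Poisson brackets are bivector fields -/

section Bivector

universe u

variable {E : Type u} [NormedAddCommGroup E] [NormedSpace ℝ E]

theorem contDiff_coe (φ : C^∞⟮𝓘(ℝ, E), E; ℝ⟯) : ContDiff ℝ ∞ φ :=
  φ.contMDiff.contDiff

/-- A smooth function on a vector space, as a smooth function on the manifold. -/
def ofContDiff (f : E → ℝ) (hf : ContDiff ℝ ∞ f) : C^∞⟮𝓘(ℝ, E), E; ℝ⟯ := ⟨f, hf.contMDiff⟩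

theorem differential_eq_fderiv (φ : C^∞⟮𝓘(ℝ, E), E; ℝ⟯) (g : E) :
    differential φ g = (fderiv ℝ φ g : E →L[ℝ] ℝ).toLinearMap := by
  rw [differential, mfderiv_eq_fderiv]

/-- A linear form, as a smooth function. -/
def linearFun : (E →L[ℝ] ℝ) →ₗ[ℝ] C^∞⟮𝓘(ℝ, E), E; ℝ⟯ where
  toFun ξ := ofContDiff ξ ξ.contDiff
  map_add' _ _ := rfl
  map_smul' _ _ := rfl

@[simp] theorem coe_linearFun (ξ : E →L[ℝ] ℝ) : ⇑(linearFun ξ) = ξ := rfl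

theorem eq_sum_smul_coord [FiniteDimensional ℝ E] {ι : Type*} [Fintype ι]
    (b : Module.Basis ι ℝ E) (ξ : E →L[ℝ] ℝ) :
    ξ = ∑ i, ξ (b i) • (b.coord i).toContinuousLinearMap := by
  refine ContinuousLinearMap.coe_injective (b.ext fun j => ?_)
  classical simp [Finsupp.single_apply]

namespace IsPoissonBracket

variable {B : C^∞⟮𝓘(ℝ, E), E; ℝ⟯ → C^∞⟮𝓘(ℝ, E), E; ℝ⟯ → C^∞⟮𝓘(ℝ, E), E; ℝ⟯}

theorem add_right (hB : IsPoissonBracket B) (φ ψ χ : C^∞⟮𝓘(ℝ, E), E; ℝ⟯) :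
    B φ (ψ + χ) = B φ ψ + B φ χ := by
  rw [hB.skew, hB.add_left, hB.skew ψ, hB.skew χ]
  abel

theorem smul_right (hB : IsPoissonBracket B) (c : ℝ) (φ ψ : C^∞⟮𝓘(ℝ, E), E; ℝ⟯) :
    B φ (c • ψ) = c • B φ ψ := by
  rw [hB.skew, hB.smul_left, hB.skew ψ, smul_neg, neg_neg]

/-- A Poisson bracket as a bilinear map. -/
def toBilin (hB : IsPoissonBracket B) :
    C^∞⟮𝓘(ℝ, E), E; ℝ⟯ →ₗ[ℝ] C^∞⟮𝓘(ℝ, E), E; ℝ⟯ →ₗ[ℝ] C^∞⟮𝓘(ℝ, E), E; ℝ⟯ :=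
  LinearMap.mk₂ ℝ B hB.add_left hB.smul_left hB.add_right hB.smul_right

theorem toBilin_apply (hB : IsPoissonBracket B) (φ ψ : C^∞⟮𝓘(ℝ, E), E; ℝ⟯) :
    hB.toBilin φ ψ = B φ ψ := rfl

theorem apply_one (hB : IsPoissonBracket B) (φ : C^∞⟮𝓘(ℝ, E), E; ℝ⟯) : B φ 1 = 0 := by
  have h := hB.leibniz φ 1 1
  rw [mul_one, mul_one, one_mul] at h
  exact left_eq_add.1 h

variable [FiniteDimensional ℝ E]

/-- The value at `g` of a Poisson bracket depends on its second argument through the differential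
at `g` only. -/
theorem apply_eq_apply_linearFun (hB : IsPoissonBracket B) (φ ψ : C^∞⟮𝓘(ℝ, E), E; ℝ⟯) (g : E) :
    B φ ψ g = B φ (linearFun (fderiv ℝ ψ g)) g := by
  obtain ⟨k, hk, hψ, hkg⟩ := exists_contDiff_eq_add_apply_sub (contDiff_coe ψ) g
  let b := Module.finBasis ℝ E
  let c : Fin (Module.finrank ℝ E) → E →L[ℝ] ℝ := fun i => (b.coord i).toContinuousLinearMap
  let κ : Fin (Module.finrank ℝ E) → C^∞⟮𝓘(ℝ, E), E; ℝ⟯ := fun i =>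
    ofContDiff (fun x => k x (b i)) (hk.clm_apply contDiff_const)
  -- Hadamard's lemma in the algebra of smooth functions, with respect to the basis `b`.
  have hdec : ψ = ψ g • (1 : C^∞⟮𝓘(ℝ, E), E; ℝ⟯) +
      ∑ i, (linearFun (c i) - c i g • (1 : C^∞⟮𝓘(ℝ, E), E; ℝ⟯)) * κ i := by
    ext x
    have hx : k x (x - g) = ∑ i, (c i x - c i g) * k x (b i) := by
      conv_lhs => rw [← b.sum_repr (x - g)]
      simp [c]
    have hs : (∑ i, (linearFun (c i) - c i g • (1 : C^∞⟮𝓘(ℝ, E), E; ℝ⟯)) * κ i :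
        C^∞⟮𝓘(ℝ, E), E; ℝ⟯) x = ∑ i, (c i x - c i g) * k x (b i) := by
      rw [← ContMDiffMap.coeFnAddMonoidHom_apply, map_sum, Finset.sum_apply]
      refine Finset.sum_congr rfl fun i _ => ?_
      change (c i x - c i g * 1) * k x (b i) = _
      rw [mul_one]
    change ψ x = ψ g * 1 + _
    rw [hs, ← hx, mul_one]
    exact hψ x
  have hlin : fderiv ℝ ψ g = ∑ i, k g (b i) • c i := by
    rw [← hkg]
    exact eq_sum_smul_coord b _
  have heval : ∀ f : Fin (Module.finrank ℝ E) → C^∞⟮𝓘(ℝ, E), E; ℝ⟯,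
      (∑ i, f i) g = ∑ i, f i g := fun f => by
    rw [← ContMDiffMap.coeFnAddMonoidHom_apply, map_sum, Finset.sum_apply]
    rfl
  have key : ∀ i, B φ ((linearFun (c i) - c i g • (1 : C^∞⟮𝓘(ℝ, E), E; ℝ⟯)) * κ i) g =
      k g (b i) * B φ (linearFun (c i)) g := fun i => by
    rw [hB.leibniz, ← hB.toBilin_apply φ (_ - _), map_sub, map_smul, hB.toBilin_apply,
      hB.toBilin_apply, hB.apply_one, smul_zero, sub_zero]
    change B φ (linearFun (c i)) g * k g (b i) + (c i g - c i g * 1) * _ = _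
    ring
  rw [hlin, map_sum]
  conv_lhs => rw [hdec]
  rw [← hB.toBilin_apply, map_add, map_smul, map_sum, hB.toBilin_apply, hB.apply_one, smul_zero,
    zero_add, heval, ← hB.toBilin_apply φ (∑ _, _), map_sum, heval]
  refine Finset.sum_congr rfl fun i _ => ?_
  rw [map_smul, map_smul]
  exact key i

theorem eq_linearFun (hB : IsPoissonBracket B) (φ ψ : C^∞⟮𝓘(ℝ, E), E; ℝ⟯) (g : E) :
    B φ ψ g = B (linearFun (fderiv ℝ φ g)) (linearFun (fderiv ℝ ψ g)) g := by
  rw [hB.apply_eq_apply_linearFun, hB.skew]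
  change -(B _ _ g) = _
  rw [hB.apply_eq_apply_linearFun, hB.skew (linearFun (fderiv ℝ φ g))]
  rfl

/-- The value at `g` of the bivector field of a Poisson bracket, in terms of a basis of `E`. -/
def bivector (_hB : IsPoissonBracket B) (g : E) : E ⊗[ℝ] E :=
  ∑ i, ∑ j, B (linearFun ((Module.finBasis ℝ E).coord i).toContinuousLinearMap)
    (linearFun ((Module.finBasis ℝ E).coord j).toContinuousLinearMap) g •
      ((Module.finBasis ℝ E) i ⊗ₜ[ℝ] (Module.finBasis ℝ E) j)

theorem dualDistrib_bivector_eq_sum (hB : IsPoissonBracket B) (g : E) (ξ η : Module.Dual ℝ E) :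
    TensorProduct.dualDistrib ℝ E E (ξ ⊗ₜ[ℝ] η) (hB.bivector g) =
      ∑ i, ∑ j, B (linearFun ((Module.finBasis ℝ E).coord i).toContinuousLinearMap)
        (linearFun ((Module.finBasis ℝ E).coord j).toContinuousLinearMap) g *
          (ξ (Module.finBasis ℝ E i) * η (Module.finBasis ℝ E j)) := by
  simp [bivector]

theorem dualDistrib_bivector (hB : IsPoissonBracket B) (g : E) (ξ η : Module.Dual ℝ E) :
    TensorProduct.dualDistrib ℝ E E (ξ ⊗ₜ[ℝ] η) (hB.bivector g) =
      B (linearFun ξ.toContinuousLinearMap) (linearFun η.toContinuousLinearMap) g := by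
  rw [dualDistrib_bivector_eq_sum]
  let β : (E →L[ℝ] ℝ) →ₗ[ℝ] (E →L[ℝ] ℝ) →ₗ[ℝ] ℝ :=
    LinearMap.mk₂ ℝ (fun ξ η => B (linearFun ξ) (linearFun η) g)
      (fun _ _ _ => by rw [map_add, hB.add_left]; rfl)
      (fun _ _ _ => by rw [map_smul, hB.smul_left]; rfl)
      (fun _ _ _ => by rw [map_add, hB.add_right]; rfl)
      (fun _ _ _ => by rw [map_smul, hB.smul_right]; rfl)
  change _ = β _ _
  rw [eq_sum_smul_coord (Module.finBasis ℝ E) ξ.toContinuousLinearMap,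
    eq_sum_smul_coord (Module.finBasis ℝ E) η.toContinuousLinearMap]
  simp only [map_sum, map_smul, LinearMap.sum_apply, LinearMap.smul_apply, smul_eq_mul,
    Finset.mul_sum]
  rw [Finset.sum_comm]
  refine Finset.sum_congr rfl fun i _ => Finset.sum_congr rfl fun j _ => ?_
  change _ = η _ * (ξ _ * B _ _ g)
  ring

theorem eq_dualDistrib_bivector (hB : IsPoissonBracket B) (φ ψ : C^∞⟮𝓘(ℝ, E), E; ℝ⟯) (g : E) :
    B φ ψ g = TensorProduct.dualDistrib ℝ E E
      ((fderiv ℝ φ g).toLinearMap ⊗ₜ[ℝ] (fderiv ℝ ψ g).toLinearMap) (hB.bivector g) := by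
  rw [hB.eq_linearFun, dualDistrib_bivector]
  rfl

end IsPoissonBracket

end Bivector

/-! ### Lie group structures on vector spaces -/

section LieGroupOnVectorSpace

universe u

variable {E : Type u} [NormedAddCommGroup E] [NormedSpace ℝ E] [Group E]

theorem Ad_eq (g : E) :
    Ad (E := E) g = (fderiv ℝ (fun a : E => g * a * g⁻¹) 1 : E →L[ℝ] E).toLinearMap := by
  rw [Ad, mfderiv_eq_fderiv]

theorem rightTranslation_eq (g : E) :
    rightTranslation (E := E) g = (fderiv ℝ (fun a : E => a * g) 1 : E →L[ℝ] E).toLinearMap := by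
  rw [rightTranslation, mfderiv_eq_fderiv]

/-- The pairing of a 2-tensor over the Lie algebra with two covectors. The tangent space at the
identity is taken to be `E` itself. -/
def pairing (ξ η : Module.Dual ℝ E) : E ⊗[ℝ] E →ₗ[ℝ] ℝ :=
  TensorProduct.dualDistrib ℝ E E (ξ ⊗ₜ[ℝ] η)

namespace IsIntegratingCocycle

variable {θ : GroupLieAlgebra 𝓘(ℝ, E) E →ₗ[ℝ]
    GroupLieAlgebra 𝓘(ℝ, E) E ⊗[ℝ] GroupLieAlgebra 𝓘(ℝ, E) E}
  {F F' : E → GroupLieAlgebra 𝓘(ℝ, E) E ⊗[ℝ] GroupLieAlgebra 𝓘(ℝ, E) E}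

theorem contDiff_pairing (hF : IsIntegratingCocycle θ F) (ξ η : Module.Dual ℝ E) :
    ContDiff ℝ ∞ (fun g => pairing ξ η (F g)) :=
  ContMDiff.contDiff (hF.smooth ξ η)

theorem fderiv_pairing_one (hF : IsIntegratingCocycle θ F) (ξ η : Module.Dual ℝ E) (v : E) :
    fderiv ℝ (fun g => pairing ξ η (F g)) 1 v = pairing ξ η (θ v) := by
  have h := hF.deriv_one ξ η v
  rw [mfderiv_eq_fderiv] at h
  exact h

theorem pairing_mul (hF : IsIntegratingCocycle θ F) (ξ η : Module.Dual ℝ E) (g h : E) :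
    pairing ξ η (F (g * h)) = pairing ξ η (F g) +
      pairing (E := E) (ξ ∘ₗ Ad (E := E) g) (η ∘ₗ Ad (E := E) g) (F h) := by
  have h1 : F (g * h) = F g + TensorProduct.map (Ad (E := E) g) (Ad (E := E) g) (F h) :=
    hF.cocycle g h
  rw [h1]
  refine (map_add (pairing ξ η) _ _).trans ?_
  congr 1
  exact dualDistrib_map (V := E) (W := E) (Ad (E := E) g) (Ad (E := E) g) ξ η (F h)

end IsIntegratingCocycle

variable [LieGroup 𝓘(ℝ, E) ∞ E]

theorem contDiff_mul : ContDiff ℝ ∞ (fun p : E × E => p.1 * p.2) := by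
  have h := contMDiff_mul 𝓘(ℝ, E) ∞ (G := E)
  rw [← modelWithCornersSelf_prod, chartedSpaceSelf_prod] at h
  exact h.contDiff

theorem contDiff_inv : ContDiff ℝ ∞ (fun g : E => g⁻¹) :=
  (contMDiff_inv 𝓘(ℝ, E) ∞ (G := E)).contDiff

theorem contDiff_mul_left (g : E) : ContDiff ℝ ∞ (fun a : E => g * a) :=
  contDiff_mul.comp (contDiff_const.prodMk contDiff_id)

theorem contDiff_mul_right (g : E) : ContDiff ℝ ∞ (fun a : E => a * g) :=
  contDiff_mul.comp (contDiff_id.prodMk contDiff_const)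

theorem differentiable_mul_left (g : E) : Differentiable ℝ (fun a : E => g * a) :=
  (contDiff_mul_left g).differentiable (by simp)

theorem differentiable_mul_right (g : E) : Differentiable ℝ (fun a : E => a * g) :=
  (contDiff_mul_right g).differentiable (by simp)

theorem fderiv_mul_left_comp (g h a : E) :
    fderiv ℝ (fun x : E => g * x) (h * a) ∘L fderiv ℝ (fun x : E => h * x) a =
      fderiv ℝ (fun x : E => (g * h) * x) a := by
  rw [← fderiv_comp (𝕜 := ℝ) a (differentiable_mul_left g _) (differentiable_mul_left h _)]
  simp only [Function.comp_def, mul_assoc]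

theorem fderiv_mul_right_comp (g h a : E) :
    fderiv ℝ (fun x : E => x * h) (a * g) ∘L fderiv ℝ (fun x : E => x * g) a =
      fderiv ℝ (fun x : E => x * (g * h)) a := by
  rw [← fderiv_comp (𝕜 := ℝ) a (differentiable_mul_right h _) (differentiable_mul_right g _)]
  simp only [Function.comp_def, mul_assoc]

/-! ### Uniqueness of the integrating cocycle -/

namespace IsIntegratingCocycle

variable {θ : GroupLieAlgebra 𝓘(ℝ, E) E →ₗ[ℝ]
    GroupLieAlgebra 𝓘(ℝ, E) E ⊗[ℝ] GroupLieAlgebra 𝓘(ℝ, E) E}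
  {F F' : E → GroupLieAlgebra 𝓘(ℝ, E) E ⊗[ℝ] GroupLieAlgebra 𝓘(ℝ, E) E}

variable [FiniteDimensional ℝ E]

/-- A cocycle is determined by its derivative at the identity: by the cocycle identity, the
differential at `g` of the difference of two cocycles is a transform of the differential at `1`,
so it vanishes. -/
theorem eq (hF : IsIntegratingCocycle θ F) (hF' : IsIntegratingCocycle θ F') : F' = F := by
  have key : ∀ (ξ η : Module.Dual ℝ E) (g : E),
      fderiv ℝ (fun g => pairing ξ η (F' g) - pairing ξ η (F g)) g = 0 := by
    intro ξ η g
    set D : E → ℝ := fun g => pairing ξ η (F' g) - pairing ξ η (F g) with hD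
    have hDd : Differentiable ℝ D :=
      ((hF'.contDiff_pairing ξ η).sub (hF.contDiff_pairing ξ η)).differentiable (by simp)
    set ξ' : Module.Dual ℝ E := ξ ∘ₗ Ad (E := E) g
    set η' : Module.Dual ℝ E := η ∘ₗ Ad (E := E) g
    have h1 : (fun h => D (g * h)) =
        fun h => D g + (pairing ξ' η' (F' h) - pairing ξ' η' (F h)) := by
      funext h
      simp only [hD, hF.pairing_mul ξ η, hF'.pairing_mul ξ η]
      ring
    have h2 : fderiv ℝ (fun h => D (g * h)) 1 = 0 := by
      rw [h1, fderiv_const_add, fderiv_fun_sub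
        ((hF'.contDiff_pairing ξ' η').differentiable (by simp) _)
        ((hF.contDiff_pairing ξ' η').differentiable (by simp) _)]
      ext v
      simp only [sub_apply, zero_apply]
      rw [hF.fderiv_pairing_one, hF'.fderiv_pairing_one, sub_self]
    -- The image of the derivative of the left translation by `g` is all of `E`, by `h4` below.
    have h3 : (fderiv ℝ D g) ∘L fderiv ℝ (fun h => g * h) 1 = 0 := by
      rw [← h2]
      have := fderiv_comp (𝕜 := ℝ) (g := D) (f := fun h : E => g * h) 1 (hDd _)
        (differentiable_mul_left g _)
      rw [mul_one] at this
      exact this.symm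
    have h4 : fderiv ℝ (fun h : E => g * h) 1 ∘L fderiv ℝ (fun h : E => g⁻¹ * h) g =
        ContinuousLinearMap.id ℝ E := by
      have := fderiv_mul_left_comp g g⁻¹ g
      rw [inv_mul_cancel, mul_inv_cancel] at this
      rw [this]
      simp only [one_mul]
      exact fderiv_fun_id
    calc fderiv ℝ D g = fderiv ℝ D g ∘L ContinuousLinearMap.id ℝ E := rfl
      _ = 0 := by rw [← h4, ← ContinuousLinearMap.comp_assoc, h3, ContinuousLinearMap.zero_comp]
  have hone : ∀ {F : E → GroupLieAlgebra 𝓘(ℝ, E) E ⊗[ℝ] GroupLieAlgebra 𝓘(ℝ, E) E},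
      IsIntegratingCocycle θ F → ∀ ξ η : Module.Dual ℝ E, pairing ξ η (F 1) = 0 := by
    intro F hF ξ η
    have h := hF.pairing_mul ξ η 1 1
    have hAd : Ad (E := E) (1 : E) = LinearMap.id := by
      rw [Ad_eq]
      simp only [one_mul, inv_one, mul_one, fderiv_fun_id]
      rfl
    rw [hAd, mul_one] at h
    exact left_eq_add.1 h
  funext g
  refine ext_dualDistrib (V := E) fun ξ η => ?_
  have hdiff : Differentiable ℝ fun g => pairing ξ η (F' g) - pairing ξ η (F g) :=
    ((hF'.contDiff_pairing ξ η).sub (hF.contDiff_pairing ξ η)).differentiable (by simp)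
  have h := is_const_of_fderiv_eq_zero hdiff (key ξ η) g 1
  rw [hone hF, hone hF', sub_zero] at h
  exact sub_eq_zero.1 h

end IsIntegratingCocycle

/-! ### The cocycle of a Poisson–Lie group -/

namespace IsPoissonLie

variable {B : C^∞⟮𝓘(ℝ, E), E; ℝ⟯ → C^∞⟮𝓘(ℝ, E), E; ℝ⟯ → C^∞⟮𝓘(ℝ, E), E; ℝ⟯}

theorem apply_one_eq_zero (hB : IsPoissonLie B) (φ ψ : C^∞⟮𝓘(ℝ, E), E; ℝ⟯) : B φ ψ 1 = 0 := by
  have h := hB.multiplicative φ ψ 1 1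
  have hR : ∀ φ : C^∞⟮𝓘(ℝ, E), E; ℝ⟯, φ.comp (smoothRightMul 𝓘(ℝ, E) 1) = φ := fun φ => by
    ext x
    simp
  have hL : ∀ φ : C^∞⟮𝓘(ℝ, E), E; ℝ⟯, φ.comp (smoothLeftMul 𝓘(ℝ, E) 1) = φ := fun φ => by
    ext x
    simp
  rw [hR, hR, hL, hL, mul_one] at h
  exact left_eq_add.1 h

variable [FiniteDimensional ℝ E]

theorem contDiff_apply_fderiv_mul_inv (ξ : Module.Dual ℝ E) (v : E) :
    ContDiff ℝ ∞ (fun g : E => ξ (fderiv ℝ (fun x : E => x * g⁻¹) g v)) := by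
  have h : ContDiff ℝ ∞ (fun p : E × E => p.2 * p.1⁻¹) :=
    contDiff_mul.comp (contDiff_snd.prodMk (contDiff_inv.comp contDiff_fst))
  have hT : ContDiff ℝ ∞ (fun g : E => fderiv ℝ (fun x : E => x * g⁻¹) g) :=
    ContDiff.fderiv (f := fun g x : E => x * g⁻¹) h contDiff_id (by simp)
  exact ξ.toContinuousLinearMap.contDiff.comp (hT.clm_apply contDiff_const)

/-- The bivector field of a Poisson–Lie group, translated to the identity from the right:
`F(g) = (R_{g⁻¹})_* π(g)`. -/
def rightTrivialization (hB : IsPoissonLie B) (g : E) : E ⊗[ℝ] E :=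
  TensorProduct.map (fderiv ℝ (fun x : E => x * g⁻¹) g).toLinearMap
    (fderiv ℝ (fun x : E => x * g⁻¹) g).toLinearMap (hB.toIsPoissonBracket.bivector g)

theorem pairing_rightTrivialization (hB : IsPoissonLie B) (g : E) (ξ η : Module.Dual ℝ E) :
    pairing ξ η (hB.rightTrivialization g) =
      pairing (ξ ∘ₗ (fderiv ℝ (fun x : E => x * g⁻¹) g).toLinearMap)
        (η ∘ₗ (fderiv ℝ (fun x : E => x * g⁻¹) g).toLinearMap)
        (hB.toIsPoissonBracket.bivector g) :=
  dualDistrib_map _ _ _ _ _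

/-- The components of `F(g)`, as values at `g` of brackets of right translates of linear forms. In
this form multiplicativity can be applied to them. -/
theorem pairing_rightTrivialization_eq (hB : IsPoissonLie B) (g : E) (ξ η : E →L[ℝ] ℝ) :
    pairing ξ.toLinearMap η.toLinearMap (hB.rightTrivialization g) =
      B ((linearFun ξ).comp (smoothRightMul 𝓘(ℝ, E) g⁻¹))
        ((linearFun η).comp (smoothRightMul 𝓘(ℝ, E) g⁻¹)) g := by
  rw [hB.toIsPoissonBracket.eq_dualDistrib_bivector, pairing_rightTrivialization]
  have h : ∀ ξ : E →L[ℝ] ℝ, fderiv ℝ ((linearFun ξ).comp (smoothRightMul 𝓘(ℝ, E) g⁻¹)) g =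
      ξ ∘L fderiv ℝ (fun x : E => x * g⁻¹) g := fun ξ =>
    (fderiv_comp (𝕜 := ℝ) (g := ξ) g ξ.differentiableAt (differentiable_mul_right g⁻¹ g)).trans
      (by rw [ξ.fderiv])
  rw [h, h]
  rfl

theorem pairing_rightTrivialization_eq_sum (hB : IsPoissonLie B) (g : E)
    (ξ η : Module.Dual ℝ E) :
    pairing ξ η (hB.rightTrivialization g) =
      ∑ i, ∑ j, B (linearFun ((Module.finBasis ℝ E).coord i).toContinuousLinearMap)
        (linearFun ((Module.finBasis ℝ E).coord j).toContinuousLinearMap) g *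
          (ξ (fderiv ℝ (fun x : E => x * g⁻¹) g (Module.finBasis ℝ E i)) *
            η (fderiv ℝ (fun x : E => x * g⁻¹) g (Module.finBasis ℝ E j))) := by
  rw [pairing_rightTrivialization]
  exact hB.toIsPoissonBracket.dualDistrib_bivector_eq_sum _ _ _

theorem contDiff_pairing_rightTrivialization (hB : IsPoissonLie B) (ξ η : Module.Dual ℝ E) :
    ContDiff ℝ ∞ (fun g => pairing ξ η (hB.rightTrivialization g)) := by
  simp only [pairing_rightTrivialization_eq_sum]
  exact ContDiff.sum fun i _ => ContDiff.sum fun j _ =>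
    (contDiff_coe _).mul ((contDiff_apply_fderiv_mul_inv ξ _).mul
      (contDiff_apply_fderiv_mul_inv η _))

theorem comm_rightTrivialization (hB : IsPoissonLie B) (g : E) :
    TensorProduct.comm ℝ E E (hB.rightTrivialization g) = -hB.rightTrivialization g := by
  refine ext_dualDistrib fun ξ η => ?_
  rw [dualDistrib_comm, map_neg]
  refine (hB.pairing_rightTrivialization_eq g η.toContinuousLinearMap
    ξ.toContinuousLinearMap).trans ?_
  rw [hB.skew]
  exact congrArg Neg.neg (hB.pairing_rightTrivialization_eq g ξ.toContinuousLinearMap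
    η.toContinuousLinearMap).symm

/-- The cocycle identity for `F`: in the multiplicativity of the bracket, the summand at `g` is
`F(g)`, and the summand at `h` involves the functions `x ↦ ξ(g x h⁻¹ g⁻¹)`, hence `Ad g`. -/
theorem pairing_rightTrivialization_mul (hB : IsPoissonLie B) (g h : E) (ξ η : E →L[ℝ] ℝ) :
    pairing ξ.toLinearMap η.toLinearMap (hB.rightTrivialization (g * h)) =
      pairing ξ.toLinearMap η.toLinearMap (hB.rightTrivialization g) +
      pairing (E := E) (ξ.toLinearMap ∘ₗ Ad (E := E) g) (η.toLinearMap ∘ₗ Ad (E := E) g)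
        (hB.rightTrivialization h) := by
  rw [pairing_rightTrivialization_eq, pairing_rightTrivialization_eq, hB.multiplicative]
  congr 1
  · have hR : ∀ φ : C^∞⟮𝓘(ℝ, E), E; ℝ⟯,
        (φ.comp (smoothRightMul 𝓘(ℝ, E) (g * h)⁻¹)).comp (smoothRightMul 𝓘(ℝ, E) h) =
          φ.comp (smoothRightMul 𝓘(ℝ, E) g⁻¹) := fun φ => by
      ext x
      simp
    rw [hR, hR]
  · rw [hB.toIsPoissonBracket.eq_dualDistrib_bivector, pairing_rightTrivialization]
    have hd : ∀ ξ : E →L[ℝ] ℝ, (fderiv ℝ (((linearFun ξ).comp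
        (smoothRightMul 𝓘(ℝ, E) (g * h)⁻¹)).comp (smoothLeftMul 𝓘(ℝ, E) g)) h).toLinearMap =
        (ξ.toLinearMap ∘ₗ Ad (E := E) g) ∘ₗ (fderiv ℝ (fun x : E => x * h⁻¹) h).toLinearMap := by
      intro ξ
      have hfun : ⇑(((linearFun ξ).comp (smoothRightMul 𝓘(ℝ, E) (g * h)⁻¹)).comp
          (smoothLeftMul 𝓘(ℝ, E) g)) = ξ ∘ (fun a : E => g * a * g⁻¹) ∘ fun x : E => x * h⁻¹ := by
        funext x
        simp [mul_assoc]
      have hc : Differentiable ℝ (fun a : E => g * a * g⁻¹) :=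
        (differentiable_mul_right g⁻¹).comp (differentiable_mul_left g)
      rw [hfun, fderiv_comp (𝕜 := ℝ) _ ξ.differentiableAt
        ((hc _).comp _ (differentiable_mul_right _ _)),
        fderiv_comp (𝕜 := ℝ) _ (hc _) (differentiable_mul_right _ _), ξ.fderiv, mul_inv_cancel,
        Ad_eq]
      rfl
    rw [hd, hd]
    rfl

/-- The translation to the identity does not affect the derivative at the identity, where the
bivector field vanishes. -/
theorem fderiv_pairing_rightTrivialization (hB : IsPoissonLie B) (ξ η : E →L[ℝ] ℝ) :
    fderiv ℝ (fun g => pairing ξ.toLinearMap η.toLinearMap (hB.rightTrivialization g)) 1 =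
      fderiv ℝ (B (linearFun ξ) (linearFun η)) 1 := by
  -- A factor which vanishes at `1` is the only one to be differentiated there.
  have hmul : ∀ (c : C^∞⟮𝓘(ℝ, E), E; ℝ⟯) (m : E → ℝ), c 1 = 0 → ContDiff ℝ ∞ m →
      HasFDerivAt (fun g => c g * m g) (m 1 • fderiv ℝ c 1) 1 := fun c m hc hm => by
    have h := (((contDiff_coe c).differentiable (by simp)) 1).hasFDerivAt.mul
      ((hm.differentiable (by simp)) 1).hasFDerivAt
    rwa [hc, zero_smul, zero_add] at h
  have hsum := fun m : Fin _ → Fin _ → E → ℝ => fun hm : ∀ i j, ContDiff ℝ ∞ (m i j) =>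
    (HasFDerivAt.fun_sum (u := Finset.univ) fun i _ =>
      HasFDerivAt.fun_sum (u := Finset.univ) fun j _ =>
      hmul (B (linearFun ((Module.finBasis ℝ E).coord i).toContinuousLinearMap)
        (linearFun ((Module.finBasis ℝ E).coord j).toContinuousLinearMap)) (m i j)
        (hB.apply_one_eq_zero _ _) (hm i j)).fderiv
  have hBsum : ⇑(B (linearFun ξ) (linearFun η)) = fun g =>
      ∑ i, ∑ j, B (linearFun ((Module.finBasis ℝ E).coord i).toContinuousLinearMap)
        (linearFun ((Module.finBasis ℝ E).coord j).toContinuousLinearMap) g *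
          (ξ (Module.finBasis ℝ E i) * η (Module.finBasis ℝ E j)) := by
    funext g
    exact (hB.toIsPoissonBracket.dualDistrib_bivector g ξ.toLinearMap η.toLinearMap).symm.trans
      (hB.toIsPoissonBracket.dualDistrib_bivector_eq_sum g ξ.toLinearMap η.toLinearMap)
  simp only [pairing_rightTrivialization_eq_sum, hBsum]
  rw [hsum _ fun _ _ => (contDiff_apply_fderiv_mul_inv ξ.toLinearMap _).mul
      (contDiff_apply_fderiv_mul_inv η.toLinearMap _), hsum _ fun _ _ => contDiff_const]
  have hid : fderiv ℝ (fun x : E => x * 1⁻¹) 1 = ContinuousLinearMap.id ℝ E := by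
    simp only [inv_one, mul_one]
    exact fderiv_fun_id
  simp only [hid]
  rfl

theorem isIntegratingCocycle (hB : IsPoissonLie B)
    {θ : GroupLieAlgebra 𝓘(ℝ, E) E →ₗ[ℝ]
      GroupLieAlgebra 𝓘(ℝ, E) E ⊗[ℝ] GroupLieAlgebra 𝓘(ℝ, E) E}
    (hθ : IsLinearization B θ) : IsIntegratingCocycle θ hB.rightTrivialization where
  smooth ξ η := (hB.contDiff_pairing_rightTrivialization ξ η).contMDiff
  skew := hB.comm_rightTrivialization
  cocycle g h := by
    refine ext_dualDistrib (V := E) fun ξ η => ?_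
    refine (hB.pairing_rightTrivialization_mul g h ξ.toContinuousLinearMap
      η.toContinuousLinearMap).trans ?_
    refine Eq.trans ?_ (map_add (pairing ξ η) _ _).symm
    congr 1
    exact (dualDistrib_map (V := E) (W := E) (Ad (E := E) g) (Ad (E := E) g) ξ η
      (hB.rightTrivialization h)).symm
  deriv_one ξ η v := by
    have h := hθ (linearFun (LinearMap.toContinuousLinearMap (E := E) ξ))
      (linearFun (LinearMap.toContinuousLinearMap (E := E) η)) v
    have hd : ∀ ξ : E →L[ℝ] ℝ, differential (linearFun ξ) (1 : E) = ξ.toLinearMap := fun ξ => by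
      rw [differential_eq_fderiv, coe_linearFun, ξ.fderiv]
    rw [hd, hd, differential_eq_fderiv] at h
    rw [mfderiv_eq_fderiv]
    refine Eq.trans ?_ h
    exact congrArg (fun L : E →L[ℝ] ℝ => L v) (hB.fderiv_pairing_rightTrivialization
      (LinearMap.toContinuousLinearMap (E := E) ξ) (LinearMap.toContinuousLinearMap (E := E) η))

theorem isRightTranslate (hB : IsPoissonLie B) : IsRightTranslate hB.rightTrivialization B := by
  intro φ ψ g
  rw [hB.toIsPoissonBracket.eq_dualDistrib_bivector]
  have hid : fderiv ℝ (fun x : E => x * g) 1 ∘L fderiv ℝ (fun x : E => x * g⁻¹) g =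
      ContinuousLinearMap.id ℝ E := by
    have := fderiv_mul_right_comp g⁻¹ g g
    rw [inv_mul_cancel, mul_inv_cancel] at this
    rw [this]
    simp only [mul_one]
    exact fderiv_fun_id
  have hid' : (fderiv ℝ (fun x : E => x * g) 1).toLinearMap ∘ₗ
      (fderiv ℝ (fun x : E => x * g⁻¹) g).toLinearMap = LinearMap.id :=
    congrArg ContinuousLinearMap.toLinearMap hid
  have hmap : TensorProduct.map (fderiv ℝ (fun x : E => x * g) 1).toLinearMap
      (fderiv ℝ (fun x : E => x * g) 1).toLinearMap (hB.rightTrivialization g) =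
        hB.toIsPoissonBracket.bivector g := by
    rw [rightTrivialization, ← LinearMap.comp_apply, ← TensorProduct.map_comp, hid',
      TensorProduct.map_id, LinearMap.id_apply]
  rw [differential_eq_fderiv, differential_eq_fderiv, rightTranslation_eq]
  exact congrArg _ hmap.symm

/-- A Poisson–Lie bracket is determined by its linearization at the identity. -/
theorem eq (hB : IsPoissonLie B)
    {B' : C^∞⟮𝓘(ℝ, E), E; ℝ⟯ → C^∞⟮𝓘(ℝ, E), E; ℝ⟯ → C^∞⟮𝓘(ℝ, E), E; ℝ⟯} (hB' : IsPoissonLie B')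
    {θ : GroupLieAlgebra 𝓘(ℝ, E) E →ₗ[ℝ]
      GroupLieAlgebra 𝓘(ℝ, E) E ⊗[ℝ] GroupLieAlgebra 𝓘(ℝ, E) E}
    (hθ : IsLinearization B θ) (hθ' : IsLinearization B' θ) : B' = B := by
  have hF := (hB.isIntegratingCocycle hθ).eq (hB'.isIntegratingCocycle hθ')
  have hr := hB'.isRightTranslate
  rw [hF] at hr
  funext φ ψ
  ext g
  rw [hr φ ψ g, hB.isRightTranslate φ ψ g]

end IsPoissonLie

end LieGroupOnVectorSpace

/-! ### Poisson brackets with Casimir coefficients -/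

section Sharp

universe u

variable {E : Type u} [NormedAddCommGroup E] [NormedSpace ℝ E]

/-- The bracket `{φ, ψ} = dψ(P dφ)` of the bivector field `P`, which is given as a field of maps
from covectors to vectors. -/
def sharpBracket (P : E → (E →L[ℝ] ℝ) →L[ℝ] E) (hP : ContDiff ℝ ∞ P)
    (φ ψ : C^∞⟮𝓘(ℝ, E), E; ℝ⟯) : C^∞⟮𝓘(ℝ, E), E; ℝ⟯ :=
  ofContDiff (fun x => fderiv ℝ ψ x (P x (fderiv ℝ φ x))) <|
    (contDiff_infty_iff_fderiv.1 (contDiff_coe ψ)).2.clm_apply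
      (hP.clm_apply (contDiff_infty_iff_fderiv.1 (contDiff_coe φ)).2)

variable {P : E → (E →L[ℝ] ℝ) →L[ℝ] E} {hP : ContDiff ℝ ∞ P}

theorem sharpBracket_apply (φ ψ : C^∞⟮𝓘(ℝ, E), E; ℝ⟯) (x : E) :
    sharpBracket P hP φ ψ x = fderiv ℝ ψ x (P x (fderiv ℝ φ x)) := rfl

theorem hasFDerivAt_coe (φ : C^∞⟮𝓘(ℝ, E), E; ℝ⟯) (x : E) : HasFDerivAt φ (fderiv ℝ φ x) x :=
  ((contDiff_coe φ).differentiable (by simp) x).hasFDerivAt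

theorem hasFDerivAt_fderiv (φ : C^∞⟮𝓘(ℝ, E), E; ℝ⟯) (x : E) :
    HasFDerivAt (fderiv ℝ φ) (fderiv ℝ (fderiv ℝ φ) x) x :=
  ((contDiff_infty_iff_fderiv.1 (contDiff_coe φ)).2.differentiable (by simp) x).hasFDerivAt

theorem fderiv_sharpBracket_apply (φ ψ : C^∞⟮𝓘(ℝ, E), E; ℝ⟯) (x v : E) :
    fderiv ℝ (sharpBracket P hP φ ψ) x v =
      fderiv ℝ (fderiv ℝ ψ) x v (P x (fderiv ℝ φ x)) +
        fderiv ℝ ψ x (fderiv ℝ P x v (fderiv ℝ φ x)) +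
        fderiv ℝ ψ x (P x (fderiv ℝ (fderiv ℝ φ) x v)) := by
  have h := (hasFDerivAt_fderiv ψ x).clm_apply
    (((hP.differentiable (by simp) x).hasFDerivAt).clm_apply (hasFDerivAt_fderiv φ x))
  have h' : fderiv ℝ (sharpBracket P hP φ ψ) x = _ := h.fderiv
  rw [h']
  simp
  ring

/-- If `P` is skew and its coefficients are Casimir functions, that is, if `P` does not vary along
its own image, then the bracket satisfies the Jacobi identity: second derivatives are symmetric. -/
theorem isPoissonBracket_sharpBracket (hskew : ∀ x (ξ η : E →L[ℝ] ℝ), η (P x ξ) = -ξ (P x η))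
    (hcas : ∀ x ξ, fderiv ℝ P x (P x ξ) = 0) : IsPoissonBracket (sharpBracket P hP) where
  add_left φ φ' ψ := by
    ext x
    change fderiv ℝ ψ x (P x (fderiv ℝ (⇑φ + ⇑φ') x)) =
      fderiv ℝ ψ x (P x (fderiv ℝ φ x)) + fderiv ℝ ψ x (P x (fderiv ℝ φ' x))
    rw [((hasFDerivAt_coe φ x).add (hasFDerivAt_coe φ' x)).fderiv, map_add, map_add]
  smul_left c φ ψ := by
    ext x
    change fderiv ℝ ψ x (P x (fderiv ℝ (c • ⇑φ) x)) = c • fderiv ℝ ψ x (P x (fderiv ℝ φ x))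
    rw [((hasFDerivAt_coe φ x).const_smul c).fderiv, map_smul, map_smul]
  skew φ ψ := by
    ext x
    exact hskew x _ _
  leibniz φ ψ χ := by
    ext x
    change fderiv ℝ (⇑ψ * ⇑χ) x (P x (fderiv ℝ φ x)) =
      fderiv ℝ ψ x (P x (fderiv ℝ φ x)) * χ x + ψ x * fderiv ℝ χ x (P x (fderiv ℝ φ x))
    rw [((hasFDerivAt_coe ψ x).mul (hasFDerivAt_coe χ x)).fderiv]
    simp
    ring
  jacobi φ ψ χ := by
    ext x
    have hsymm : ∀ (φ : C^∞⟮𝓘(ℝ, E), E; ℝ⟯) (v w : E),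
        fderiv ℝ (fderiv ℝ φ) x v w = fderiv ℝ (fderiv ℝ φ) x w v := fun φ v w =>
      ((contDiff_coe φ).contDiffAt.isSymmSndFDerivAt
        (by simp; exact WithTop.coe_le_coe.2 le_top)).eq v w
    change fderiv ℝ (sharpBracket P hP ψ χ) x (P x (fderiv ℝ φ x)) +
      fderiv ℝ (sharpBracket P hP χ φ) x (P x (fderiv ℝ ψ x)) +
      fderiv ℝ (sharpBracket P hP φ ψ) x (P x (fderiv ℝ χ x)) = 0
    simp only [fderiv_sharpBracket_apply, hcas, zero_apply, map_zero, add_zero]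
    rw [hskew x (fderiv ℝ (fderiv ℝ ψ) x _), hskew x (fderiv ℝ (fderiv ℝ χ) x _),
      hskew x (fderiv ℝ (fderiv ℝ φ) x _), hsymm χ (P x (fderiv ℝ ψ x)),
      hsymm ψ (P x (fderiv ℝ χ x)), hsymm φ (P x (fderiv ℝ χ x))]
    ring

theorem mlieBracket_eq_lieBracket (V W : ∀ x : E, TangentSpace 𝓘(ℝ, E) x) (x : E) :
    VectorField.mlieBracket 𝓘(ℝ, E) V W x = VectorField.lieBracket ℝ V W x := by
  rw [← VectorField.mlieBracketWithin_univ, VectorField.mlieBracketWithin_eq_lieBracketWithin]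
  exact congrFun (VectorField.lieBracketWithin_univ (V := V) (W := W)) x

variable [Group E]

/-- The bracket of the Lie algebra of a Lie group which is a vector space, in terms of the
derivatives of its left-invariant vector fields. -/
theorem lie_eq {m : E → E → E} (hm : ∀ g h : E, g * h = m g h) {e : E} (he : 1 = e)
    (v w : GroupLieAlgebra 𝓘(ℝ, E) E) :
    ⁅v, w⁆ = fderiv ℝ (fun g : E => fderiv ℝ (m g) e w) e (fderiv ℝ (m e) e v) -
      fderiv ℝ (fun g : E => fderiv ℝ (m g) e v) e (fderiv ℝ (m e) e w) := by
  obtain rfl : (fun g h : E => g * h) = m := funext₂ hm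
  subst he
  have h : ∀ v : GroupLieAlgebra 𝓘(ℝ, E) E, mulInvariantVectorField (I := 𝓘(ℝ, E)) (G := E) v =
      fun g : E => fderiv ℝ (fun x : E => g * x) 1 v := fun v => by
    funext g
    exact congrArg (fun L : E →L[ℝ] E => L v) mfderiv_eq_fderiv
  rw [GroupLieAlgebra.bracket_def, h, h]
  exact mlieBracket_eq_lieBracket _ _ _

theorem isLinearization_sharpBracket {e : E} (he : 1 = e) (hone : P e = 0)
    {θ : GroupLieAlgebra 𝓘(ℝ, E) E →ₗ[ℝ]
      GroupLieAlgebra 𝓘(ℝ, E) E ⊗[ℝ] GroupLieAlgebra 𝓘(ℝ, E) E}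
    (hθ : ∀ (ξ η : E →L[ℝ] ℝ) (v : E), η (fderiv ℝ P e v ξ) =
      pairing ξ.toLinearMap η.toLinearMap (θ v)) :
    IsLinearization (sharpBracket P hP) θ := by
  subst he
  intro φ ψ v
  rw [differential_eq_fderiv, differential_eq_fderiv, differential_eq_fderiv]
  refine Eq.trans ?_ (hθ _ _ v)
  refine (fderiv_sharpBracket_apply φ ψ 1 v).trans ?_
  simp [hone]

variable [LieGroup 𝓘(ℝ, E) ∞ E]

theorem isPoissonLie_sharpBracket (hB : IsPoissonBracket (sharpBracket P hP))
    {m : E → E → E} (hm : ∀ g h : E, g * h = m g h)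
    (hmul : ∀ g h : E, ∃ R L : E →L[ℝ] E, HasFDerivAt (fun x => m x h) R g ∧
      HasFDerivAt (m g) L h ∧
      ∀ ξ : E →L[ℝ] ℝ, P (m g h) ξ = R (P g (ξ ∘L R)) + L (P h (ξ ∘L L))) :
    IsPoissonLie (sharpBracket P hP) where
  toIsPoissonBracket := hB
  multiplicative φ ψ g h := by
    obtain rfl : (fun g h : E => g * h) = m := funext₂ hm
    obtain ⟨R, L, hR, hL, hP'⟩ := hmul g h
    have hφR : ∀ φ : C^∞⟮𝓘(ℝ, E), E; ℝ⟯, fderiv ℝ (φ.comp (smoothRightMul 𝓘(ℝ, E) h)) g =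
        fderiv ℝ φ (g * h) ∘L R := fun φ => ((hasFDerivAt_coe φ (g * h)).comp g hR).fderiv
    have hφL : ∀ φ : C^∞⟮𝓘(ℝ, E), E; ℝ⟯, fderiv ℝ (φ.comp (smoothLeftMul 𝓘(ℝ, E) g)) h =
        fderiv ℝ φ (g * h) ∘L L := fun φ => ((hasFDerivAt_coe φ (g * h)).comp h hL).fderiv
    simp only [sharpBracket_apply, hφR, hφL, hP', map_add]
    rfl

end Sharp

/-! ### A common form of the three groups -/

section Twisted

variable {n : ℕ}

theorem dualDistrib_eval {V : Type*} [AddCommGroup V] [Module ℝ V]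
    (T : Module.Dual ℝ V ⊗[ℝ] Module.Dual ℝ V) (X Y : V) :
    TensorProduct.dualDistrib ℝ (Module.Dual ℝ V) (Module.Dual ℝ V)
        (Module.Dual.eval ℝ V X ⊗ₜ[ℝ] Module.Dual.eval ℝ V Y) T =
      TensorProduct.dualDistrib ℝ V V T (X ⊗ₜ[ℝ] Y) := by
  induction T with
  | zero => simp
  | tmul u v => simp
  | add s t hs ht => simp only [map_add, hs, ht, LinearMap.add_apply]

/-- The cobracket `θ(p, q, r) = r ∑ᵢ 𝐩ᵢ ∧ 𝐪ᵢ`, by its components. -/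
theorem pairing_theta [Group (Vec n)] (ξ η : Module.Dual ℝ (Vec n))
    (v : Vec n) : pairing ξ η (theta n (Vec n) v) =
      v.2.2 * ((toHeis ξ).x ⬝ᵥ (toHeis η).y - (toHeis η).x ⬝ᵥ (toHeis ξ).y) := by
  have h : ∀ ξ : Module.Dual ℝ (Vec n),
      ξ ∘ₗ (coord n).symm.toLinearMap = Module.Dual.eval ℝ (Heis n) (toHeis ξ) := fun ξ => by
    ext μ
    simp [← coord_toHeis]
  refine (dualDistrib_map (V := Module.Dual ℝ (Heis n)) (W := Vec n) (coord n).symm.toLinearMap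
    (coord n).symm.toLinearMap ξ η (dualCobracket (Heis n) (coord n v))).trans ?_
  rw [h, h, dualDistrib_eval, dualDistrib_dualCobracket, coord_apply, Heis.lie_def]
  simp

theorem apply_eq_dotProduct (ξ : Module.Dual ℝ (Vec n)) (v : Vec n) :
    ξ v = v.1 ⬝ᵥ (toHeis ξ).x + v.2.1 ⬝ᵥ (toHeis ξ).y + v.2.2 * (toHeis ξ).z := by
  rw [← coord_toHeis, coord_apply]

/-- The coordinate `r` on `ℝⁿ × ℝⁿ × ℝ`. -/
def coordR (n : ℕ) : Vec n →L[ℝ] ℝ :=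
  (ContinuousLinearMap.snd ℝ (Fin n → ℝ) ℝ).comp
    (ContinuousLinearMap.snd ℝ (Fin n → ℝ) ((Fin n → ℝ) × ℝ))

section SmulAddSmul

variable {E F : Type*} [NormedAddCommGroup E] [NormedSpace ℝ E] [NormedAddCommGroup F]
  [NormedSpace ℝ F] {a b : ℝ → ℝ}

theorem contDiff_smul_add_smul (r : E →L[ℝ] ℝ) (ha : ContDiff ℝ ∞ a) (hb : ContDiff ℝ ∞ b)
    (P Q : F) : ContDiff ℝ ∞ (fun g => a (r g) • P + b (r g) • Q) :=
  ((ha.comp r.contDiff).smul contDiff_const).add ((hb.comp r.contDiff).smul contDiff_const)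

theorem fderiv_smul_add_smul_apply (r : E →L[ℝ] ℝ) {a' b' : ℝ} {g : E}
    (ha : HasDerivAt a a' (r g)) (hb : HasDerivAt b b' (r g)) (P Q : F) (v : E) :
    fderiv ℝ (fun g => a (r g) • P + b (r g) • Q) g v = (r v * a') • P + (r v * b') • Q := by
  have h := ((ha.hasFDerivAt.comp g r.hasFDerivAt).smul_const P).add
    ((hb.hasFDerivAt.comp g r.hasFDerivAt).smul_const Q)
  rw [HasFDerivAt.fderiv (f := fun g => a (r g) • P + b (r g) • Q) h]
  simp

end SmulAddSmul

/-- The bivector `∑ᵢ 𝐩ᵢ ∧ 𝐪ᵢ` on `ℝⁿ × ℝⁿ × ℝ`, as a map from covectors to vectors. -/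
def sharpPQ (n : ℕ) : (Vec n →L[ℝ] ℝ) →L[ℝ] Vec n :=
  LinearMap.toContinuousLinearMap
    { toFun := fun ξ => (-(toHeis ξ.toLinearMap).y, (toHeis ξ.toLinearMap).x, 0)
      map_add' := fun ξ η => by
        ext <;> simp [toHeis, add_comm]
      map_smul' := fun c ξ => by
        ext <;> simp [toHeis] }

/-- The bivector `½ ∑ᵢⱼ Jᵢⱼ 𝐪ⱼ ∧ 𝐪ᵢ` on `ℝⁿ × ℝⁿ × ℝ`, as a map from covectors to vectors. -/
def sharpQQ (J : Matrix (Fin n) (Fin n) ℝ) : (Vec n →L[ℝ] ℝ) →L[ℝ] Vec n :=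
  LinearMap.toContinuousLinearMap
    { toFun := fun ξ => (0, J.mulVec (toHeis ξ.toLinearMap).y, 0)
      map_add' := fun ξ η => by
        have : (toHeis (ξ + η).toLinearMap).y =
          (toHeis ξ.toLinearMap).y + (toHeis η.toLinearMap).y := rfl
        rw [this, Matrix.mulVec_add]
        simp
      map_smul' := fun c ξ => by
        have : (toHeis (c • ξ).toLinearMap).y = c • (toHeis ξ.toLinearMap).y := rfl
        rw [this, Matrix.mulVec_smul]
        simp }

theorem sharpPQ_apply (ξ : Vec n →L[ℝ] ℝ) :
    sharpPQ n ξ = (-(toHeis ξ.toLinearMap).y, (toHeis ξ.toLinearMap).x, 0) := rfl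

theorem sharpQQ_apply (J : Matrix (Fin n) (Fin n) ℝ) (ξ : Vec n →L[ℝ] ℝ) :
    sharpQQ J ξ = (0, J.mulVec (toHeis ξ.toLinearMap).y, 0) := rfl

/-- The bivector field `a(r) ∑ᵢ 𝐩ᵢ ∧ 𝐪ᵢ + b(r)/2 ∑ᵢⱼ Jᵢⱼ 𝐪ⱼ ∧ 𝐪ᵢ`. -/
def sharpField (a b : ℝ → ℝ) (J : Matrix (Fin n) (Fin n) ℝ) (g : Vec n) :
    (Vec n →L[ℝ] ℝ) →L[ℝ] Vec n :=
  a g.2.2 • sharpPQ n + b g.2.2 • sharpQQ J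

variable {a b : ℝ → ℝ} {J : Matrix (Fin n) (Fin n) ℝ}

theorem contDiff_sharpField (ha : ContDiff ℝ ∞ a) (hb : ContDiff ℝ ∞ b) :
    ContDiff ℝ ∞ (sharpField a b J) :=
  contDiff_smul_add_smul (coordR n) ha hb (sharpPQ n) (sharpQQ J)

theorem sharpField_apply (g : Vec n) (ξ : Vec n →L[ℝ] ℝ) :
    sharpField a b J g ξ = (-(a g.2.2 • (toHeis ξ.toLinearMap).y),
      a g.2.2 • (toHeis ξ.toLinearMap).x + b g.2.2 • J.mulVec (toHeis ξ.toLinearMap).y, 0) := by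
  simp [sharpField, sharpPQ_apply, sharpQQ_apply]

theorem apply_sharpField (g : Vec n) (ξ η : Vec n →L[ℝ] ℝ) :
    η (sharpField a b J g ξ) =
      a g.2.2 * ((toHeis ξ.toLinearMap).x ⬝ᵥ (toHeis η.toLinearMap).y -
        (toHeis η.toLinearMap).x ⬝ᵥ (toHeis ξ.toLinearMap).y) +
      b g.2.2 * (J.mulVec (toHeis ξ.toLinearMap).y ⬝ᵥ (toHeis η.toLinearMap).y) := by
  have h := apply_eq_dotProduct η.toLinearMap (sharpField a b J g ξ)
  rw [sharpField_apply] at h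
  rw [sharpField_apply]
  refine h.trans ?_
  simp [add_dotProduct, dotProduct_comm (toHeis η.toLinearMap).x]
  ring

theorem mulVec_dotProduct_of_skew (hJ : J.transpose = -J) (u v : Fin n → ℝ) :
    J.mulVec u ⬝ᵥ v = -(J.mulVec v ⬝ᵥ u) := by
  rw [dotProduct_comm, Matrix.dotProduct_mulVec, ← Matrix.mulVec_transpose, hJ, Matrix.neg_mulVec,
    neg_dotProduct]

theorem sharpField_skew (hJ : J.transpose = -J) (g : Vec n) (ξ η : Vec n →L[ℝ] ℝ) :
    η (sharpField a b J g ξ) = -ξ (sharpField a b J g η) := by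
  rw [apply_sharpField, apply_sharpField, mulVec_dotProduct_of_skew hJ]
  ring

theorem fderiv_sharpField_apply {a' b' : ℝ} {g : Vec n} (ha : HasDerivAt a a' g.2.2)
    (hb : HasDerivAt b b' g.2.2) (v : Vec n) :
    fderiv ℝ (sharpField a b J) g v = (v.2.2 * a') • sharpPQ n + (v.2.2 * b') • sharpQQ J :=
  fderiv_smul_add_smul_apply (coordR n) ha hb (sharpPQ n) (sharpQQ J) v

/-- The coefficients of `sharpField a b J` are Casimir functions. -/
theorem fderiv_sharpField_apply_sharpField (ha : ContDiff ℝ ∞ a) (hb : ContDiff ℝ ∞ b)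
    (g : Vec n) (ξ : Vec n →L[ℝ] ℝ) :
    fderiv ℝ (sharpField a b J) g (sharpField a b J g ξ) = 0 := by
  rw [fderiv_sharpField_apply (ha.differentiable (by simp) _).hasDerivAt
    (hb.differentiable (by simp) _).hasDerivAt, sharpField_apply]
  simp

/-- The multiplication `(p, q, r)(p', q', r') = (s(r') p + p', t(r') q + q' + r' Jᵀ p, r + r')`. -/
def twistedMul (s t : ℝ → ℝ) (J : Matrix (Fin n) (Fin n) ℝ) (g h : Vec n) : Vec n :=
  (s h.2.2 • g.1 + h.1, t h.2.2 • g.2.1 + h.2.1 + h.2.2 • J.transpose.mulVec g.1, g.2.2 + h.2.2)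

variable {s t : ℝ → ℝ}

theorem hasFDerivAt_twistedMul_right (g h : Vec n) :
    ∃ R : Vec n →L[ℝ] Vec n, HasFDerivAt (fun x => twistedMul s t J x h) R g ∧
      ∀ v : Vec n,
        R v = (s h.2.2 • v.1, t h.2.2 • v.2.1 + h.2.2 • J.transpose.mulVec v.1, v.2.2) := by
  let R : Vec n →ₗ[ℝ] Vec n :=
    { toFun := fun v =>
        (s h.2.2 • v.1, t h.2.2 • v.2.1 + h.2.2 • J.transpose.mulVec v.1, v.2.2)
      map_add' := fun v w => by
        ext <;> simp [Matrix.mulVec_add] <;> ring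
      map_smul' := fun c v => by
        ext <;> simp [Matrix.mulVec_smul] <;> ring }
  refine ⟨R.toContinuousLinearMap, ?_, fun v => rfl⟩
  have heq : (fun x => twistedMul s t J x h) = fun x => R.toContinuousLinearMap x + h := by
    funext x
    ext <;> simp [twistedMul, R]
    ring
  rw [heq]
  exact R.toContinuousLinearMap.hasFDerivAt.add_const h

theorem hasFDerivAt_twistedMul_left {s' t' : ℝ} (g h : Vec n) (hs : HasDerivAt s s' h.2.2)
    (ht : HasDerivAt t t' h.2.2) :
    ∃ L : Vec n →L[ℝ] Vec n, HasFDerivAt (fun x => twistedMul s t J g x) L h ∧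
      ∀ v : Vec n, L v = ((v.2.2 * s') • g.1 + v.1,
        (v.2.2 * t') • g.2.1 + v.2.1 + v.2.2 • J.transpose.mulVec g.1, v.2.2) := by
  let fst := ContinuousLinearMap.fst ℝ (Fin n → ℝ) ((Fin n → ℝ) × ℝ)
  let snd := (ContinuousLinearMap.fst ℝ (Fin n → ℝ) ℝ).comp
    (ContinuousLinearMap.snd ℝ (Fin n → ℝ) ((Fin n → ℝ) × ℝ))
  have hthd : HasFDerivAt (fun x : Vec n => x.2.2) (coordR n) h := (coordR n).hasFDerivAt
  have h1 := ((hs.hasFDerivAt.comp h hthd).smul_const g.1).add fst.hasFDerivAt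
  have h2 := (((ht.hasFDerivAt.comp h hthd).smul_const g.2.1).add snd.hasFDerivAt).add
    (hthd.smul_const (J.transpose.mulVec g.1))
  have h3 := hthd.const_add g.2.2
  refine ⟨_, h1.prodMk (h2.prodMk h3), fun v => ?_⟩
  ext <;> simp [fst, snd, coordR]

end Twisted

/-! ### The Poisson–Lie structures on the groups in the common form -/

section TwistedGroup

variable {n : ℕ} {J : Matrix (Fin n) (Fin n) ℝ} {a b s t : ℝ → ℝ}

/-- The transpose of the derivative of a right translation, on the coordinates `x` and `y`. -/
theorem toHeis_comp_right {R : Vec n →L[ℝ] Vec n} {α β ρ : ℝ}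
    (hR : ∀ v : Vec n, R v = (α • v.1, β • v.2.1 + ρ • J.transpose.mulVec v.1, v.2.2))
    (ξ : Vec n →L[ℝ] ℝ) :
    (toHeis (ξ ∘L R).toLinearMap).x =
        α • (toHeis ξ.toLinearMap).x + ρ • J.mulVec (toHeis ξ.toLinearMap).y ∧
      (toHeis (ξ ∘L R).toLinearMap).y = β • (toHeis ξ.toLinearMap).y := by
  constructor
  · funext i
    change ξ (R (Pi.single i 1, 0, 0)) = _
    rw [hR]
    refine (apply_eq_dotProduct ξ.toLinearMap _).trans ?_
    simp only [zero_mul, add_zero, smul_dotProduct, smul_zero, zero_add, single_one_dotProduct,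
      Matrix.mulVec_transpose, ← Matrix.dotProduct_mulVec]
    rfl
  · funext i
    change ξ (R (0, Pi.single i 1, 0)) = _
    rw [hR]
    refine (apply_eq_dotProduct ξ.toLinearMap _).trans ?_
    simp

/-- Left translations fix the directions `p` and `q`, so their transposes fix the coordinates `x` and
`y`. -/
theorem toHeis_comp_left {L : Vec n →L[ℝ] Vec n}
    (hL : ∀ v : Vec n, v.2.2 = 0 → L v = v) (ξ : Vec n →L[ℝ] ℝ) :
    (toHeis (ξ ∘L L).toLinearMap).x = (toHeis ξ.toLinearMap).x ∧
      (toHeis (ξ ∘L L).toLinearMap).y = (toHeis ξ.toLinearMap).y := by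
  constructor
  · funext i
    exact congrArg ξ (hL _ rfl)
  · funext i
    exact congrArg ξ (hL _ rfl)

/-- The bivector field `sharpField a b J` is multiplicative for `twistedMul s t J`. -/
theorem sharpField_twistedMul (hJ : J.transpose = -J)
    (ha : ∀ r r', a (r + r') = s r' * t r' * a r + a r')
    (hb : ∀ r r', b (r + r') • J = (t r' ^ 2 * b r + 2 * r' * t r' * a r + b r') • J)
    (g h : Vec n) {R L : Vec n →L[ℝ] Vec n}
    (hR : ∀ v : Vec n,
      R v = (s h.2.2 • v.1, t h.2.2 • v.2.1 + h.2.2 • J.transpose.mulVec v.1, v.2.2))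
    (hL : ∀ v : Vec n, v.2.2 = 0 → L v = v) (ξ : Vec n →L[ℝ] ℝ) :
    sharpField a b J (twistedMul s t J g h) ξ =
      R (sharpField a b J g (ξ ∘L R)) + L (sharpField a b J h (ξ ∘L L)) := by
  obtain ⟨hRx, hRy⟩ := toHeis_comp_right hR ξ
  obtain ⟨hLx, hLy⟩ := toHeis_comp_left hL ξ
  have hbJ : ∀ u : Fin n → ℝ, b (g.2.2 + h.2.2) • J.mulVec u =
      (t h.2.2 ^ 2 * b g.2.2 + 2 * h.2.2 * t h.2.2 * a g.2.2 + b h.2.2) • J.mulVec u := fun u => by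
    rw [← Matrix.smul_mulVec, hb, Matrix.smul_mulVec]
  rw [hL _ (by rw [sharpField_apply]), hR, sharpField_apply, sharpField_apply, sharpField_apply,
    hRx, hRy, hLx, hLy, hJ]
  refine Prod.ext ?_ (Prod.ext ?_ ?_)
  · simp only [twistedMul, ha, Prod.fst_add, add_smul, neg_add, smul_neg, smul_smul]
    congr 3
    ring
  · simp only [twistedMul, ha, hbJ, Prod.fst_add, Prod.snd_add, Matrix.mulVec_smul,
      Matrix.neg_mulVec, Matrix.mulVec_neg]
    module
  · simp

theorem dual_ext {μ ν : Module.Dual ℝ (Heis n)} (hx : ∀ i, μ (Heis.eX i) = ν (Heis.eX i))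
    (hy : ∀ i, μ (Heis.eY i) = ν (Heis.eY i)) (hz : μ Heis.eZ = ν Heis.eZ) : μ = ν :=
  (coord n).symm.injective (Prod.ext (funext hx) (Prod.ext (funext hy) hz))

theorem coord_eX (v : Vec n) (i : Fin n) : coord n v (Heis.eX i) = v.1 i := by
  simp [coord_apply, Heis.eX]

theorem coord_eY (v : Vec n) (i : Fin n) : coord n v (Heis.eY i) = v.2.1 i := by
  simp [coord_apply, Heis.eY]

theorem coord_eZ (v : Vec n) : coord n v Heis.eZ = v.2.2 := by
  simp [coord_apply, Heis.eZ]

theorem fderiv_twistedMul_left_zero {s₀ t₀ : ℝ} (hs : HasDerivAt s s₀ 0) (ht : HasDerivAt t t₀ 0)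
    (g v : Vec n) : fderiv ℝ (twistedMul s t J g) 0 v = ((v.2.2 * s₀) • g.1 + v.1,
      (v.2.2 * t₀) • g.2.1 + v.2.1 + v.2.2 • J.transpose.mulVec g.1, v.2.2) := by
  obtain ⟨L, hL, hLv⟩ := hasFDerivAt_twistedMul_left (J := J) g 0 hs ht
  rw [HasFDerivAt.fderiv (f := twistedMul s t J g) hL, hLv]

theorem fderiv_twistedMul_zero {s₀ t₀ : ℝ} (hs : HasDerivAt s s₀ 0) (ht : HasDerivAt t t₀ 0)
    (v : Vec n) : fderiv ℝ (twistedMul s t J 0) 0 v = v := by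
  rw [fderiv_twistedMul_left_zero hs ht]
  simp

/-- The derivative at the identity of the left-invariant vector field with value `v` there. -/
theorem fderiv_fderiv_twistedMul_zero {s₀ t₀ : ℝ} (hs : HasDerivAt s s₀ 0)
    (ht : HasDerivAt t t₀ 0) (v u : Vec n) :
    fderiv ℝ (fun g => fderiv ℝ (twistedMul s t J g) 0 v) 0 u = ((v.2.2 * s₀) • u.1,
      (v.2.2 * t₀) • u.2.1 + v.2.2 • J.transpose.mulVec u.1, 0) := by
  let A : Vec n →ₗ[ℝ] Vec n :=
    { toFun := fun u =>
        ((v.2.2 * s₀) • u.1, (v.2.2 * t₀) • u.2.1 + v.2.2 • J.transpose.mulVec u.1, 0)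
      map_add' := fun v w => by
        ext <;> simp [Matrix.mulVec_add] <;> ring
      map_smul' := fun c v => by
        ext <;> simp [Matrix.mulVec_smul] <;> ring }
  have heq : (fun g => fderiv ℝ (twistedMul s t J g) 0 v) = fun g =>
      A.toContinuousLinearMap g + v := by
    funext g
    rw [fderiv_twistedMul_left_zero hs ht]
    ext <;> simp [A]
    ring
  rw [heq, fderiv_add_const, ContinuousLinearMap.fderiv]
  rfl

theorem coord_lie_twistedMul {s₀ t₀ : ℝ} (hs : HasDerivAt s s₀ 0) (ht : HasDerivAt t t₀ 0)
    {δ : Heis n →ₗ[ℝ] Heis n ⊗[ℝ] Heis n}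
    (hX : ∀ j, δ (Heis.eX j) = s₀ • wedge (Heis.eX j) Heis.eZ)
    (hY : ∀ j, δ (Heis.eY j) = t₀ • wedge (Heis.eY j) Heis.eZ +
      ∑ i, J i j • wedge (Heis.eX i) Heis.eZ)
    (hZ : δ Heis.eZ = 0) (v w : Vec n) :
    coord n (fderiv ℝ (fun g => fderiv ℝ (twistedMul s t J g) 0 w) 0
        (fderiv ℝ (twistedMul s t J 0) 0 v) -
      fderiv ℝ (fun g => fderiv ℝ (twistedMul s t J g) 0 v) 0
        (fderiv ℝ (twistedMul s t J 0) 0 w)) = dualBracket δ (coord n v) (coord n w) := by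
  rw [fderiv_twistedMul_zero hs ht, fderiv_twistedMul_zero hs ht,
    fderiv_fderiv_twistedMul_zero hs ht, fderiv_fderiv_twistedMul_zero hs ht]
  refine dual_ext (fun j => ?_) (fun j => ?_) ?_
  · rw [coord_eX]
    simp only [dualBracket, hX, wedge, LinearMap.comp_apply, map_smul, map_sub,
      TensorProduct.dualDistrib_apply, coord_eX, coord_eZ, smul_eq_mul, Prod.fst_sub, Pi.sub_apply,
      Pi.smul_apply]
    ring
  · rw [coord_eY]
    simp only [dualBracket, hY, wedge, LinearMap.comp_apply, map_smul, map_sub, map_add, map_sum,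
      TensorProduct.dualDistrib_apply, coord_eX, coord_eY, coord_eZ, smul_eq_mul, Prod.fst_sub,
      Prod.snd_sub, Pi.sub_apply, Pi.add_apply, Pi.smul_apply, mul_sub, Finset.sum_sub_distrib,
      Matrix.mulVec, dotProduct, Matrix.transpose_apply, Finset.mul_sum]
    have h1 : ∀ v w : Vec n, ∑ i, J i j * (v.1 i * w.2.2) = ∑ i, w.2.2 * (J i j * v.1 i) :=
      fun v w => Finset.sum_congr rfl fun i _ => by ring
    have h2 : ∑ i, J i j * (v.2.2 * w.1 i) = ∑ i, v.2.2 * (J i j * w.1 i) :=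
      Finset.sum_congr rfl fun i _ => by ring
    rw [h1, h2]
    ring
  · simp [dualBracket, hZ, coord_eZ]

/-- The multiplication and the unit are those of `grp`, not the componentwise ones of the product
`ℝⁿ × ℝⁿ × ℝ`. -/
theorem isDualLieGroup_twistedMul [grp : Group (Vec n)] [lie : LieGroup 𝓘(ℝ, Vec n) ∞ (Vec n)]
    (hmul : ∀ g h : Vec n, grp.mul g h = twistedMul s t J g h) (hone : grp.one = (0 : Vec n))
    {s₀ t₀ : ℝ} (hs : HasDerivAt s s₀ 0) (ht : HasDerivAt t t₀ 0)
    {δ : Heis n →ₗ[ℝ] Heis n ⊗[ℝ] Heis n}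
    (hX : ∀ j, δ (Heis.eX j) = s₀ • wedge (Heis.eX j) Heis.eZ)
    (hY : ∀ j, δ (Heis.eY j) = t₀ • wedge (Heis.eY j) Heis.eZ +
      ∑ i, J i j • wedge (Heis.eX i) Heis.eZ)
    (hZ : δ Heis.eZ = 0) : IsDualLieGroup δ (lieCoord n (Vec n)) where
  lieGroup := lie
  simplyConnected := inferInstance
  map_lie v w := (congrArg (coord n) (lie_eq hmul hone v w)).trans
    (coord_lie_twistedMul hs ht hX hY hZ v w)

/-- The functional equation for `b` is multiplied by `J`, so that it is void for `J = 0`. -/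
theorem exists_isPoissonLie_twistedMul [grp : Group (Vec n)]
    [LieGroup 𝓘(ℝ, Vec n) ∞ (Vec n)]
    (hmul : ∀ g h : Vec n, grp.mul g h = twistedMul s t J g h) (hone : grp.one = (0 : Vec n))
    (hs : Differentiable ℝ s) (ht : Differentiable ℝ t) (hJ : J.transpose = -J)
    (hac : ContDiff ℝ ∞ a) (hbc : ContDiff ℝ ∞ b)
    (ha₀ : a 0 = 0) (hb₀ : b 0 = 0) (ha₁ : HasDerivAt a 1 0) (hb₁ : HasDerivAt b 0 0)
    (ha : ∀ r r', a (r + r') = s r' * t r' * a r + a r')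
    (hb : ∀ r r', b (r + r') • J = (t r' ^ 2 * b r + 2 * r' * t r' * a r + b r') • J) :
    ∃ B : C^∞⟮𝓘(ℝ, Vec n), Vec n; ℝ⟯ → C^∞⟮𝓘(ℝ, Vec n), Vec n; ℝ⟯ →
        C^∞⟮𝓘(ℝ, Vec n), Vec n; ℝ⟯,
      (IsPoissonLie B ∧ IsLinearization B (theta n (Vec n))) ∧
      (∀ B', IsPoissonLie B' ∧ IsLinearization B' (theta n (Vec n)) → B' = B) ∧
      (∃ F, IsIntegratingCocycle (theta n (Vec n)) F ∧
        (∀ F', IsIntegratingCocycle (theta n (Vec n)) F' → F' = F) ∧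
        IsRightTranslate F B) ∧
      ∀ (φ ψ : C^∞⟮𝓘(ℝ, Vec n), Vec n; ℝ⟯) (g : Vec n) (x y x' y' : Fin n → ℝ) (z z' : ℝ),
        heisDifferential φ g = Heis.mk x y z → heisDifferential ψ g = Heis.mk x' y' z' →
        B φ ψ g = a g.2.2 * (x ⬝ᵥ y' - x' ⬝ᵥ y) + b g.2.2 * (J.mulVec y ⬝ᵥ y') := by
  have hPB : IsPoissonBracket (sharpBracket (sharpField a b J) (contDiff_sharpField hac hbc)) :=
    isPoissonBracket_sharpBracket (sharpField_skew hJ)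
      (fderiv_sharpField_apply_sharpField hac hbc)
  have hB : IsPoissonLie (sharpBracket (sharpField a b J) (contDiff_sharpField hac hbc)) := by
    refine isPoissonLie_sharpBracket hPB hmul fun g h => ?_
    obtain ⟨R, hR, hRv⟩ := hasFDerivAt_twistedMul_right (s := s) (t := t) (J := J) g h
    obtain ⟨L, hL, hLv⟩ := hasFDerivAt_twistedMul_left (J := J) g h (hs _).hasDerivAt
      (ht _).hasDerivAt
    refine ⟨R, L, hR, hL, sharpField_twistedMul hJ ha hb g h hRv fun v hv => ?_⟩
    rw [hLv, hv]
    ext <;> simp [hv]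
  have hθ : IsLinearization (sharpBracket (sharpField a b J) (contDiff_sharpField hac hbc))
      (theta n (Vec n)) := by
    refine isLinearization_sharpBracket hone (by simp [sharpField, ha₀, hb₀]) fun ξ η v => ?_
    rw [pairing_theta, fderiv_sharpField_apply (g := 0) ha₁ hb₁]
    have h := apply_sharpField (a := fun r => r) (b := 0) (J := J) v ξ η
    simpa [sharpField] using h
  refine ⟨_, ⟨hB, hθ⟩, fun B' hB' => hB.eq hB'.1 hθ hB'.2,
    ⟨_, hB.isIntegratingCocycle hθ, fun F' hF' => (hB.isIntegratingCocycle hθ).eq hF',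
      hB.isRightTranslate⟩, fun φ ψ g x y x' y' z z' hφ hψ => ?_⟩
  have h := apply_sharpField (a := a) (b := b) (J := J) g (fderiv ℝ φ g) (fderiv ℝ ψ g)
  rw [heisDifferential, differential_eq_fderiv] at hφ hψ
  have hφ' : toHeis (fderiv ℝ φ g).toLinearMap = Heis.mk x y z := hφ
  have hψ' : toHeis (fderiv ℝ ψ g).toLinearMap = Heis.mk x' y' z' := hψ
  rw [hφ', hψ'] at h
  exact h

end TwistedGroup

/-! ### The three groups -/

section ThreeGroups

variable {n : ℕ}

theorem hasDerivAt_exp_mul_zero (c : ℝ) : HasDerivAt (fun r => Real.exp (c * r)) c 0 := by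
  simpa using ((hasDerivAt_id (0 : ℝ)).const_mul c).exp

theorem Group₁.mul_eq_twistedMul (lam : ℝ) (g h : Vec n) :
    Group₁.mulFun lam g h =
      twistedMul (fun r => Real.exp (lam * r)) (fun r => Real.exp (-lam * r)) 0 g h := by
  simp [Group₁.mulFun, twistedMul]

theorem Group₂.mul_eq_twistedMul (lam : ℝ) (g h : Vec n) :
    Group₂.mulFun lam g h =
      twistedMul (fun r => Real.exp (lam * r)) (fun r => Real.exp (lam * r)) 0 g h := by
  simp [Group₂.mulFun, twistedMul]

theorem Group₃.mul_eq_twistedMul (J : Matrix (Fin n) (Fin n) ℝ) (g h : Vec n) :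
    Group₃.mulFun J g h = twistedMul (fun _ => 1) (fun _ => 1) J g h := by
  ext <;> simp [Group₃.mulFun, twistedMul, Matrix.mulVec, dotProduct]

theorem sum_mul_sub_eq_mulVec_dotProduct {J : Matrix (Fin n) (Fin n) ℝ} (hJ : J.transpose = -J)
    (y y' : Fin n → ℝ) :
    ∑ k, ∑ j, J k j * (y j * y' k - y k * y' j) = 2 * (J.mulVec y ⬝ᵥ y') := by
  have h : ∀ u v : Fin n → ℝ, J.mulVec u ⬝ᵥ v = ∑ k, ∑ j, J k j * (u j * v k) := fun u v => by
    simp only [dotProduct, Matrix.mulVec, Finset.sum_mul]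
    exact Finset.sum_congr rfl fun k _ => Finset.sum_congr rfl fun j _ => by ring
  have h' : ∑ k, ∑ j, J k j * (y k * y' j) = J.mulVec y' ⬝ᵥ y := by
    rw [h]
    exact Finset.sum_congr rfl fun k _ => Finset.sum_congr rfl fun j _ => by ring
  simp only [mul_sub, Finset.sum_sub_distrib]
  rw [← h, h', mulVec_dotProduct_of_skew hJ y']
  ring

end ThreeGroups

end HeisenbergDual

end

open HeisenbergDual in
theorem proposition1p3 (n : ℕ) :
    (∀ lam : ℝ, lam ≠ 0 →
      (∀ (p q p' q' : Fin n → ℝ) (r r' : ℝ),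
        (Group₁.mk p q r * Group₁.mk p' q' r' : Group₁ n lam) =
          Group₁.mk (Real.exp (lam * r') • p + p') (Real.exp (-(lam * r')) • q + q') (r + r')) ∧
      IsDualLieGroup (Heis.cobracket₁ n lam) (lieCoord n (Group₁ n lam)) ∧
      ∃ B : C^∞⟮𝓘(ℝ, Vec n), Group₁ n lam; ℝ⟯ → C^∞⟮𝓘(ℝ, Vec n), Group₁ n lam; ℝ⟯ →
          C^∞⟮𝓘(ℝ, Vec n), Group₁ n lam; ℝ⟯,
        (IsPoissonLie B ∧ IsLinearization B (theta n (Group₁ n lam))) ∧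
        (∀ B', IsPoissonLie B' ∧ IsLinearization B' (theta n (Group₁ n lam)) → B' = B) ∧
        (∃ F, IsIntegratingCocycle (theta n (Group₁ n lam)) F ∧
          (∀ F', IsIntegratingCocycle (theta n (Group₁ n lam)) F' → F' = F) ∧
          IsRightTranslate F B) ∧
        ∀ (φ ψ : C^∞⟮𝓘(ℝ, Vec n), Group₁ n lam; ℝ⟯) (p q : Fin n → ℝ) (r : ℝ) (x y x' y' : Fin n → ℝ)
          (z z' : ℝ),
          heisDifferential φ (Group₁.mk p q r) = Heis.mk x y z →
          heisDifferential ψ (Group₁.mk p q r) = Heis.mk x' y' z' →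
          B φ ψ (Group₁.mk p q r) = r * (x ⬝ᵥ y' - x' ⬝ᵥ y)) ∧
    (∀ lam : ℝ, lam ≠ 0 →
      (∀ (p q p' q' : Fin n → ℝ) (r r' : ℝ),
        (Group₂.mk p q r * Group₂.mk p' q' r' : Group₂ n lam) =
          Group₂.mk (Real.exp (lam * r') • p + p') (Real.exp (lam * r') • q + q') (r + r')) ∧
      IsDualLieGroup (Heis.cobracket₂ n lam) (lieCoord n (Group₂ n lam)) ∧
      ∃ B : C^∞⟮𝓘(ℝ, Vec n), Group₂ n lam; ℝ⟯ → C^∞⟮𝓘(ℝ, Vec n), Group₂ n lam; ℝ⟯ →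
          C^∞⟮𝓘(ℝ, Vec n), Group₂ n lam; ℝ⟯,
        (IsPoissonLie B ∧ IsLinearization B (theta n (Group₂ n lam))) ∧
        (∀ B', IsPoissonLie B' ∧ IsLinearization B' (theta n (Group₂ n lam)) → B' = B) ∧
        (∃ F, IsIntegratingCocycle (theta n (Group₂ n lam)) F ∧
          (∀ F', IsIntegratingCocycle (theta n (Group₂ n lam)) F' → F' = F) ∧
          IsRightTranslate F B) ∧
        ∀ (φ ψ : C^∞⟮𝓘(ℝ, Vec n), Group₂ n lam; ℝ⟯) (p q : Fin n → ℝ) (r : ℝ) (x y x' y' : Fin n → ℝ)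
          (z z' : ℝ),
          heisDifferential φ (Group₂.mk p q r) = Heis.mk x y z →
          heisDifferential ψ (Group₂.mk p q r) = Heis.mk x' y' z' →
          B φ ψ (Group₂.mk p q r) = (Real.exp (2 * lam * r) - 1) / (2 * lam) * (x ⬝ᵥ y' - x' ⬝ᵥ y)) ∧
    (∀ J : Matrix (Fin n) (Fin n) ℝ, J.transpose = -J →
      (∀ (p q p' q' : Fin n → ℝ) (r r' : ℝ),
        (Group₃.mk p q r * Group₃.mk p' q' r' : Group₃ J) =
          Group₃.mk (p + p') (fun j => q j + q' j + r' * ∑ i, J i j * p i) (r + r')) ∧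
      IsDualLieGroup (Heis.cobracket₃ J) (lieCoord n (Group₃ J)) ∧
      ∃ B : C^∞⟮𝓘(ℝ, Vec n), Group₃ J; ℝ⟯ → C^∞⟮𝓘(ℝ, Vec n), Group₃ J; ℝ⟯ →
          C^∞⟮𝓘(ℝ, Vec n), Group₃ J; ℝ⟯,
        (IsPoissonLie B ∧ IsLinearization B (theta n (Group₃ J))) ∧
        (∀ B', IsPoissonLie B' ∧ IsLinearization B' (theta n (Group₃ J)) → B' = B) ∧
        (∃ F, IsIntegratingCocycle (theta n (Group₃ J)) F ∧
          (∀ F', IsIntegratingCocycle (theta n (Group₃ J)) F' → F' = F) ∧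
          IsRightTranslate F B) ∧
        ∀ (φ ψ : C^∞⟮𝓘(ℝ, Vec n), Group₃ J; ℝ⟯) (p q : Fin n → ℝ) (r : ℝ) (x y x' y' : Fin n → ℝ)
          (z z' : ℝ),
          heisDifferential φ (Group₃.mk p q r) = Heis.mk x y z →
          heisDifferential ψ (Group₃.mk p q r) = Heis.mk x' y' z' →
          B φ ψ (Group₃.mk p q r) = r * (x ⬝ᵥ y' - x' ⬝ᵥ y) +
            r ^ 2 / 2 * ∑ k, ∑ j, J k j * (y j * y' k - y k * y' j)) := by
  refine ⟨fun lam hlam => ⟨Group₁.mk_mul_mk, ?_, ?_⟩, fun lam hlam => ⟨Group₂.mk_mul_mk, ?_, ?_⟩,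
    fun J hJ => ⟨Group₃.mk_mul_mk, ?_, ?_⟩⟩
  · exact @isDualLieGroup_twistedMul n 0 _ _ (inferInstance : Group (Group₁ n lam))
      (inferInstance : LieGroup 𝓘(ℝ, Vec n) ∞ (Group₁ n lam))
      (Group₁.mul_eq_twistedMul lam) rfl _ _ (hasDerivAt_exp_mul_zero lam)
      (hasDerivAt_exp_mul_zero (-lam)) _ (fun j => Heis.lift_eX _ _ _ j)
      (fun j => (Heis.lift_eY _ _ _ j).trans (by simp)) (Heis.lift_eZ _ _ _)
  · obtain ⟨B, h1, h2, h3, h4⟩ := @exists_isPoissonLie_twistedMul n 0 (fun r => r) (fun _ => 0) _ _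
      (inferInstance : Group (Group₁ n lam))
      (inferInstance : LieGroup 𝓘(ℝ, Vec n) ∞ (Group₁ n lam))
      (Group₁.mul_eq_twistedMul lam) rfl (by fun_prop) (by fun_prop) (by simp) contDiff_id
      contDiff_const rfl rfl (hasDerivAt_id 0) (hasDerivAt_const 0 0)
      (fun r r' => by simp [← Real.exp_add]) (fun r r' => by simp)
    refine ⟨B, h1, h2, h3, fun φ ψ p q r x y x' y' z z' hφ hψ => ?_⟩
    refine (h4 φ ψ (p, q, r) x y x' y' z z' hφ hψ).trans ?_
    simp
  · exact @isDualLieGroup_twistedMul n 0 _ _ (inferInstance : Group (Group₂ n lam))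
      (inferInstance : LieGroup 𝓘(ℝ, Vec n) ∞ (Group₂ n lam))
      (Group₂.mul_eq_twistedMul lam) rfl _ _ (hasDerivAt_exp_mul_zero lam)
      (hasDerivAt_exp_mul_zero lam) _ (fun j => Heis.lift_eX _ _ _ j)
      (fun j => (Heis.lift_eY _ _ _ j).trans (by simp)) (Heis.lift_eZ _ _ _)
  · obtain ⟨B, h1, h2, h3, h4⟩ := @exists_isPoissonLie_twistedMul n 0
      (fun r => (Real.exp (2 * lam * r) - 1) / (2 * lam)) (fun _ => 0) _ _
      (inferInstance : Group (Group₂ n lam))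
      (inferInstance : LieGroup 𝓘(ℝ, Vec n) ∞ (Group₂ n lam))
      (Group₂.mul_eq_twistedMul lam) rfl (by fun_prop) (by fun_prop) (by simp) (by fun_prop)
      contDiff_const (by simp) rfl
      (by
        have h := ((hasDerivAt_exp_mul_zero (2 * lam)).sub_const 1).div_const (2 * lam)
        rwa [div_self (mul_ne_zero two_ne_zero hlam)] at h)
      (hasDerivAt_const 0 0)
      (fun r r' => by
        have h : Real.exp (lam * r') * Real.exp (lam * r') = Real.exp (2 * lam * r') := by
          rw [← Real.exp_add]
          ring_nf
        rw [h, mul_add, Real.exp_add]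
        ring)
      (fun r r' => by simp)
    refine ⟨B, h1, h2, h3, fun φ ψ p q r x y x' y' z z' hφ hψ => ?_⟩
    refine (h4 φ ψ (p, q, r) x y x' y' z z' hφ hψ).trans ?_
    simp
  · exact @isDualLieGroup_twistedMul n J _ _ (inferInstance : Group (Group₃ J))
      (inferInstance : LieGroup 𝓘(ℝ, Vec n) ∞ (Group₃ J))
      (Group₃.mul_eq_twistedMul J) rfl _ _ (hasDerivAt_const 0 1)
      (hasDerivAt_const 0 1) _ (fun j => (Heis.lift_eX _ _ _ j).trans (by simp))
      (fun j => (Heis.lift_eY _ _ _ j).trans (by simp)) (Heis.lift_eZ _ _ _)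
  · obtain ⟨B, h1, h2, h3, h4⟩ := @exists_isPoissonLie_twistedMul n J (fun r => r) (fun r => r ^ 2)
      _ _ (inferInstance : Group (Group₃ J))
      (inferInstance : LieGroup 𝓘(ℝ, Vec n) ∞ (Group₃ J))
      (Group₃.mul_eq_twistedMul J) rfl (by fun_prop) (by fun_prop) hJ contDiff_id
      (by fun_prop) rfl (by simp) (hasDerivAt_id 0) (by simpa using hasDerivAt_pow 2 (0 : ℝ))
      (fun r r' => by simp)
      (fun r r' => by
        congr 1
        ring)
    refine ⟨B, h1, h2, h3, fun φ ψ p q r x y x' y' z z' hφ hψ => ?_⟩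
    refine (h4 φ ψ (p, q, r) x y x' y' z z' hφ hψ).trans ?_
    rw [sum_mul_sub_eq_mulVec_dotProduct hJ]
    ring
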